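/- **Theorem (Strong efficiency of the minimax estimator).** Let $\Sigma\in\mathbb R^{d\times d}$ be symmetric positive definite and $\mathbf l\in\mathbb R^d$ with $\mathbf l>\mathbf 0$ (inequalities between vectors are componentwise). Let $P$ be a permutation matrix, $\mathbf p=P\mathbf l$, and let $L$ be the lower triangular matrix with positive diagonal such that $LL^\top=P\Sigma P^\top$. For $\gamma>0$ put $$\ell(\gamma)=\mathbb P(\mathbf X\ge\gamma\mathbf l)=\mathbb P(L\mathbf Z\ge\gamma\mathbf p),\qquad \mathbf X\sim N(\mathbf 0,\Sigma),\ \mathbf Z\sim N(\mathbf 0,I).$$ *Ordering of the variables.* Let $d=d_1+d_2$ and write vectors and matrices in blocks of sizes $d_1,d_2$. The permutation is assumed to be such that the Karush–Kuhn–Tucker system of the quadratic program $\min\frac12\|\mathbf x\|^2$ subject to $L\mathbf x\ge\gamma\mathbf p$, namely $$\mathbf x=L^\top\boldsymbol\lambda,\quad \boldsymbol\lambda\ge\mathbf 0,\quad \gamma\mathbf p-L\mathbf x\le\mathbf 0,\quad \boldsymbol\lambda^\top(\gamma\mathbf p-L\mathbf x)=0,$$ has for every $\gamma>0$ a solution with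 $\boldsymbol\lambda_1>\mathbf 0$ (first $d_1$ components) and $\boldsymbol\lambda_2=\mathbf 0$ (last $d_2$ components). Let $$\mathbf q=L_{21}L_{11}^{-1}\mathbf p_1-\mathbf p_2,\qquad \mathscr J=\{j\in\{1,\dots,d_2\}: q_j=0\}.$$ *The estimator.* For $\gamma>0$ let $\mathscr C=\{\mathbf x: L\mathbf x\ge\gamma\mathbf p\}$, $\tilde l_k(\mathbf x)=\bigl(\gamma p_k-\sum_{j<k}L_{kj}x_j\bigr)/L_{kk}$, $\overline\Phi(t)=\mathbb P(Z>t)$ for $Z\sim N(0,1)$, let $\phi(\cdot\,;m,1)$ be the density of $N(m,1)$, and put $$\psi(\mathbf x;\boldsymbol\mu)=-\mathbf x^\top\boldsymbol\mu+\tfrac12\|\boldsymbol\mu\|^2+\sum_{k=1}^d\log\overline\Phi\bigl(\tilde l_k(\mathbf x)-\mu_k\bigr).$$ Let $\mathbb P_{\boldsymbol\mu}$ be the probability law on $\mathbb R^d$ with density $$g(\mathbf x;\boldsymbol\mu)=\prod_{k=1}^d\frac{\phi(x_k;\mu_k,1)\,\mathbb I\{x_k\ge\tilde l_k(\mathbf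 x)\}}{\overline\Phi(\tilde l_k(\mathbf x)-\mu_k)}.$$ The minimax tilting parameter $\boldsymbol\mu^*=\boldsymbol\mu^*(\gamma)$ is the $\boldsymbol\mu$-component of a solution $(\mathbf x^*,\boldsymbol\mu^*)$ of the program $$\max_{\mathbf x,\boldsymbol\mu}\ \psi(\mathbf x;\boldsymbol\mu)\quad\text{subject to}\quad \frac{\partial\psi}{\partial\boldsymbol\mu}(\mathbf x;\boldsymbol\mu)=\mathbf 0,\ \ \mathbf x\in\mathscr C ,$$ and the minimax estimator is $\hat\ell(\gamma)=\exp(\psi(\mathbf X;\boldsymbol\mu^*))$ with $\mathbf X\sim\mathbb P_{\boldsymbol\mu^*}$. *Conclusion.* For every $\gamma>0$ this program has a solution. For any choice of solutions, $\hat\ell$ is strongly efficient: if $\mathscr J=\emptyset$, it has vanishing relative error, $$\limsup_{\gamma\to\infty}\frac{\operatorname{Var}_{\boldsymbol\mu^*}(\hat\ell(\gamma))}{\ell^2(\gamma)}=0,$$ and if $\mathscr J\ne\emptyset$, it has bounded relative error, $$\limsup_{\gamma\to\infty}\frac{\operatorname{Var}_{\boldsymbol\mu^*}(\hat\ell(\gamma))}{\ell^2(\gamma)}<\infty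 .$$ -/

import Mathlib

open MeasureTheory ProbabilityTheory Filter Topology

noncomputable section

namespace MinimaxTilting

/-- Upper tail of the standard normal law, `P(Z > t)`, that is `Φ(∞) - Φ(t)`. -/
def normalTail (t : ℝ) : ℝ := (gaussianReal 0 1).real (Set.Ioi t)

/-- The tail probability `P(X ≥ γ l)` for `X ~ N(0, S)` (componentwise inequality). -/
def tailProb {n : ℕ} (S : Matrix (Fin n) (Fin n) ℝ) (l : Fin n → ℝ) (γ : ℝ) : ℝ :=
  (multivariateGaussian (0 : EuclideanSpace ℝ (Fin n)) S).real {x | ∀ i, γ * l i ≤ x i}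

/-- The feasible region `C = {x : L x ≥ b}`. -/
def feasible {n : ℕ} (L : Matrix (Fin n) (Fin n) ℝ) (b : Fin n → ℝ) : Set (Fin n → ℝ) :=
  {x | ∀ i, b i ≤ (L.mulVec x) i}

/-- Sequential lower bound
`l̃_k(x_1, …, x_{k-1}) = (b_k - ∑_{j<k} L_{kj} x_j) / L_{kk}`. -/
def seqLower {n : ℕ} (L : Matrix (Fin n) (Fin n) ℝ) (b : Fin n → ℝ) (x : Fin n → ℝ)
    (k : Fin n) : ℝ :=
  (b k - ∑ j ∈ Finset.Iio k, L k j * x j) / L k k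

/-- The log-likelihood ratio (all upper bounds being `+∞`)
`ψ(x; μ) = -xᵀμ + ‖μ‖² / 2 + ∑_k log P(Z > l̃_k(x) - μ_k)`. -/
def psi {n : ℕ} (L : Matrix (Fin n) (Fin n) ℝ) (b : Fin n → ℝ) (x μ : Fin n → ℝ) : ℝ :=
  -(∑ k, x k * μ k) + (∑ k, μ k ^ 2) / 2
    + ∑ k, Real.log (normalTail (seqLower L b x k - μ k))

/-- The sequentially tilted density
`g(x; μ) = ∏_k φ(x_k; μ_k, 1) 1{x_k ≥ l̃_k(x)} / P(Z > l̃_k(x) - μ_k)`. -/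
def tiltedDensity {n : ℕ} (L : Matrix (Fin n) (Fin n) ℝ) (b : Fin n → ℝ)
    (μ x : Fin n → ℝ) : ℝ :=
  ∏ k, Set.indicator (Set.Ici (seqLower L b x k)) (gaussianPDFReal (μ k) 1) (x k)
    / normalTail (seqLower L b x k - μ k)

/-- The sampling law `P_μ`, with density `g(·; μ)` with respect to Lebesgue measure. -/
def tiltedMeasure {n : ℕ} (L : Matrix (Fin n) (Fin n) ℝ) (b : Fin n → ℝ) (μ : Fin n → ℝ) :
    Measure (Fin n → ℝ) :=
  volume.withDensity fun x => ENNReal.ofReal (tiltedDensity L b μ x)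

/-- The constraint set of the minimax tilting program:
`∂ψ/∂μ (x; μ) = 0` and `x ∈ C`. -/
def tiltingConstraint {n : ℕ} (L : Matrix (Fin n) (Fin n) ℝ) (b : Fin n → ℝ) :
    Set ((Fin n → ℝ) × (Fin n → ℝ)) :=
  {z | HasFDerivAt (fun ν => psi L b z.1 ν) (0 : (Fin n → ℝ) →L[ℝ] ℝ) z.2 ∧
    z.1 ∈ feasible L b}

/-- `(x, μ)` solves the minimax tilting program: it maximizes `ψ(x; μ)` subject to
`∂ψ/∂μ = 0` and `x ∈ C`. -/
def IsTiltingSolution {n : ℕ} (L : Matrix (Fin n) (Fin n) ℝ) (b : Fin n → ℝ)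
    (x μ : Fin n → ℝ) : Prop :=
  (x, μ) ∈ tiltingConstraint L b ∧
    IsMaxOn (fun z : (Fin n → ℝ) × (Fin n → ℝ) => psi L b z.1 z.2) (tiltingConstraint L b) (x, μ)

/-- Karush-Kuhn-Tucker conditions, with multiplier `lam`, of the quadratic program
`min ½ ‖x‖²` subject to `L x ≥ b`. -/
structure IsKKT {n : ℕ} (L : Matrix (Fin n) (Fin n) ℝ) (b x lam : Fin n → ℝ) : Prop where
  stationary : x - L.transpose.mulVec lam = 0
  dual_nonneg : ∀ i, 0 ≤ lam i
  primal_feasible : ∀ i, b i - (L.mulVec x) i ≤ 0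
  complementary : ∑ i, lam i * (b i - (L.mulVec x) i) = 0

/-- The vector `q = L₂₁ L₁₁⁻¹ p₁ - p₂`, for the splitting of the indices into the first `d₁`
and the last `d₂`. -/
def qVec {d₁ d₂ : ℕ} (L : Matrix (Fin (d₁ + d₂)) (Fin (d₁ + d₂)) ℝ) (p : Fin (d₁ + d₂) → ℝ) :
    Fin d₂ → ℝ :=
  ((L.submatrix (Fin.natAdd d₁) (Fin.castAdd d₂)) *
      (L.submatrix (Fin.castAdd d₂) (Fin.castAdd d₂))⁻¹).mulVec (fun i => p (Fin.castAdd d₂ i))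
    - fun j => p (Fin.natAdd d₁ j)

/-- Relative variance `Var_μ(exp ψ(X; μ)) / ℓ²`, `X ~ P_μ`, as an extended nonnegative real
(an infinite variance counts as `∞`). -/
def relVariance {n : ℕ} (L : Matrix (Fin n) (Fin n) ℝ) (b μ : Fin n → ℝ) (ell : ℝ) : ENNReal :=
  evariance (fun x => Real.exp (psi L b x μ)) (tiltedMeasure L b μ) / ENNReal.ofReal (ell ^ 2)

end MinimaxTilting

end

/-! Let M bound exp ψ(·; μ*). The estimator is unbiased, and E exp(2ψ) ≤ M E exp ψ, so its relative
variance is at most M/ℓ − 1 (`relVariance_le`). It remains to compare M with ℓ, and both are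
measured against the explicit scale `tailScale`.

Upper bound on M. For fixed x, ψ is convex in μ, because the mean excess of the normal law is
decreasing; for fixed μ it is concave in x, because log P(Z > t) is concave. The program maximizes
over x the minimum of ψ over μ, so its solution is a saddle point: ψ(y; μ*) ≤ ψ(x*; μ*) ≤ ψ(x*; ν)
for all y and ν (`IsTiltingSolution.psi_le`, `psi_le_of_critical`). Hence any ν giving a uniform
bound on ψ(·; ν) also bounds M. The choice ν = γ(x − diag(L) λ), with (x, λ) a KKT pair at γ = 1,
gives `tailScale` (`IsKKT.exp_psi_le`).

Lower bound on ℓ. Centre at γx and shrink by 1/γ in the directions of the active constraints. Then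
ℓ/`tailScale` becomes a constant times an integral of local densities (`measure_feasible_eq`), whose
liminf is controlled by Fatou's lemma. The limit is a product of exponential densities (active
coordinates) and Gaussian ones (inactive), restricted to a cone cut out by the inactive constraints
tight at x. This is always positive, so the relative error is bounded. A tight inactive constraint
forces some q_j = 0; if there is none, the limit has total mass 1 and the relative error vanishes.
-/

namespace MinimaxTilting

/-! ### Hazard rate and mean excess of the standard normal law -/

section NormalTail

lemma stdPDF_eq (t : ℝ) :
    gaussianPDFReal 0 1 t = (√(2 * Real.pi))⁻¹ * Real.exp (-t ^ 2 / 2) := by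
  simp [gaussianPDFReal]

lemma stdPDF_pos (t : ℝ) : 0 < gaussianPDFReal 0 1 t :=
  gaussianPDFReal_pos 0 1 t one_ne_zero

lemma continuous_stdPDF : Continuous (gaussianPDFReal 0 1) := by
  simp only [funext stdPDF_eq]; fun_prop

lemma hasDerivAt_stdPDF (t : ℝ) :
    HasDerivAt (gaussianPDFReal 0 1) (-(t * gaussianPDFReal 0 1 t)) t := by
  have h : HasDerivAt (fun t : ℝ => -t ^ 2 / 2) (-t) t := by
    refine ((hasDerivAt_pow 2 t).neg.div_const 2).congr_deriv ?_
    simp; ring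
  simp only [funext stdPDF_eq]
  refine (h.exp.const_mul ((√(2 * Real.pi))⁻¹)).congr_deriv ?_
  ring

lemma normalTail_eq_integral (t : ℝ) :
    normalTail t = ∫ x in Set.Ioi t, gaussianPDFReal 0 1 x := by
  rw [normalTail, measureReal_def, gaussianReal_apply_eq_integral 0 one_ne_zero,
    ENNReal.toReal_ofReal]
  exact integral_nonneg fun x => gaussianPDFReal_nonneg 0 1 x

lemma normalTail_eq_sub (t : ℝ) :
    normalTail t = normalTail 0 - ∫ x in (0 : ℝ)..t, gaussianPDFReal 0 1 x := by
  rw [normalTail_eq_integral, normalTail_eq_integral,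
    ← intervalIntegral.integral_interval_add_Ioi (a := 0) (b := t)
      (integrable_gaussianPDFReal 0 1).integrableOn (integrable_gaussianPDFReal 0 1).integrableOn]
  ring

lemma hasDerivAt_normalTail (t : ℝ) :
    HasDerivAt normalTail (-gaussianPDFReal 0 1 t) t := by
  rw [funext normalTail_eq_sub]
  have h := intervalIntegral.integral_hasDerivAt_right (a := 0) (b := t)
    (continuous_stdPDF.intervalIntegrable _ _)
    (continuous_stdPDF.stronglyMeasurable.stronglyMeasurableAtFilter) continuous_stdPDF.continuousAt
  simpa using h.const_sub (normalTail 0)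

lemma continuous_normalTail : Continuous normalTail :=
  continuous_iff_continuousAt.2 fun t => (hasDerivAt_normalTail t).continuousAt

lemma normalTail_pos (t : ℝ) : 0 < normalTail t := by
  rw [normalTail_eq_integral]
  refine (setIntegral_pos_iff_support_of_nonneg_ae
    (ae_of_all _ fun x => gaussianPDFReal_nonneg 0 1 x)
    (integrable_gaussianPDFReal 0 1).integrableOn).2 ?_
  have : Function.support (gaussianPDFReal 0 1) = Set.univ := by
    ext x; simp [(stdPDF_pos x).ne']
  simp [this]

lemma normalTail_le_one (t : ℝ) : normalTail t ≤ 1 := measureReal_le_one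

lemma log_normalTail_nonpos (t : ℝ) : Real.log (normalTail t) ≤ 0 :=
  Real.log_nonpos (normalTail_pos t).le (normalTail_le_one t)

/-- Exponential bound on the normal tail, tangent at slope `s`. -/
lemma normalTail_le_exp (t : ℝ) {s : ℝ} (hs : 0 < s) :
    normalTail t ≤ Real.exp (s ^ 2 / 2 - s * t) / (√(2 * Real.pi) * s) := by
  have hi : IntegrableOn (fun x : ℝ => Real.exp (-s * x)) (Set.Ioi t) :=
    integrableOn_exp_mul_Ioi (by linarith) t
  rw [normalTail_eq_integral]
  calc ∫ x in Set.Ioi t, gaussianPDFReal 0 1 x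
      ≤ ∫ x in Set.Ioi t, (√(2 * Real.pi))⁻¹ * Real.exp (s ^ 2 / 2) * Real.exp (-s * x) := by
        refine setIntegral_mono (integrable_gaussianPDFReal 0 1).integrableOn
          (hi.const_mul _) fun x => ?_
        rw [stdPDF_eq, mul_assoc, ← Real.exp_add]
        gcongr
        nlinarith [sq_nonneg (x - s)]
    _ = Real.exp (s ^ 2 / 2 - s * t) / (√(2 * Real.pi) * s) := by
        rw [integral_const_mul, integral_exp_mul_Ioi (by linarith), sub_eq_add_neg, Real.exp_add,
          ← neg_mul]
        field_simp

lemma tendsto_pow_mul_stdPDF (k : ℕ) :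
    Tendsto (fun t : ℝ => t ^ k * gaussianPDFReal 0 1 t) atTop (𝓝 0) := by
  have h := (Real.tendsto_pow_mul_exp_neg_atTop_nhds_zero k).const_mul ((√(2 * Real.pi))⁻¹ * Real.exp (1 / 2))
  rw [mul_zero] at h
  refine squeeze_zero' ?_ ?_ h
  · filter_upwards [eventually_ge_atTop 0] with t ht
    exact mul_nonneg (pow_nonneg ht k) (stdPDF_pos t).le
  · filter_upwards [eventually_ge_atTop 0] with t ht
    have : Real.exp (-t ^ 2 / 2) ≤ Real.exp (1 / 2) * Real.exp (-t) := by
      rw [← Real.exp_add]; gcongr; nlinarith [sq_nonneg (t - 1)]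
    rw [stdPDF_eq]
    calc t ^ k * ((√(2 * Real.pi))⁻¹ * Real.exp (-t ^ 2 / 2))
        ≤ t ^ k * ((√(2 * Real.pi))⁻¹ * (Real.exp (1 / 2) * Real.exp (-t))) := by gcongr
      _ = _ := by ring

lemma tendsto_pow_mul_normalTail (k : ℕ) :
    Tendsto (fun t : ℝ => t ^ k * normalTail t) atTop (𝓝 0) := by
  have h := (Real.tendsto_pow_mul_exp_neg_atTop_nhds_zero k).const_mul (Real.exp (1 / 2) / √(2 * Real.pi))
  rw [mul_zero] at h
  refine squeeze_zero' ?_ ?_ h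
  · filter_upwards [eventually_ge_atTop 0] with t ht
    exact mul_nonneg (pow_nonneg ht k) (normalTail_pos t).le
  · filter_upwards [eventually_ge_atTop 0] with t ht
    have := normalTail_le_exp t one_pos
    rw [one_pow, one_mul, mul_one, sub_eq_add_neg, Real.exp_add] at this
    calc t ^ k * normalTail t
        ≤ t ^ k * (Real.exp (1 / 2) * Real.exp (-t) / √(2 * Real.pi)) := by gcongr
      _ = _ := by ring

/-- A function on `ℝ` with negative derivative and limit `0` at infinity is positive. -/
lemma pos_of_hasDerivAt_neg {f f' : ℝ → ℝ} (hf : ∀ t, HasDerivAt f (f' t) t)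
    (hneg : ∀ t, f' t < 0) (hlim : Tendsto f atTop (𝓝 0)) (t : ℝ) : 0 < f t := by
  have hanti : StrictAnti f := strictAnti_of_deriv_neg fun x => by rw [(hf x).deriv]; exact hneg x
  have h1 : 0 ≤ f (t + 1) := hanti.antitone.le_of_tendsto hlim (t + 1)
  exact h1.trans_lt (hanti (by linarith))

/-- First of three Mills-ratio inequalities proved in a chain: the gap between the two sides
vanishes at infinity, and its derivative is negative by the preceding inequality (here by positivity
of the tail). They yield in turn positivity of the mean excess, its bound 1/t, and its strict
decrease. -/
lemma mul_normalTail_lt_stdPDF (t : ℝ) : t * normalTail t < gaussianPDFReal 0 1 t := by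
  have := pos_of_hasDerivAt_neg (f := fun t => gaussianPDFReal 0 1 t - t * normalTail t)
    (f' := fun t => -normalTail t)
    (fun t => by
      refine ((hasDerivAt_stdPDF t).sub ((hasDerivAt_id t).mul
        (hasDerivAt_normalTail t))).congr_deriv ?_
      simp)
    (fun t => by simpa using normalTail_pos t)
    (by simpa using (tendsto_pow_mul_stdPDF 0).sub (tendsto_pow_mul_normalTail 1)) t
  simpa using this

lemma mul_stdPDF_lt (t : ℝ) :
    t * gaussianPDFReal 0 1 t < (1 + t ^ 2) * normalTail t := by
  have := pos_of_hasDerivAt_neg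
    (f := fun t => (1 + t ^ 2) * normalTail t - t * gaussianPDFReal 0 1 t)
    (f' := fun t => -(2 * (gaussianPDFReal 0 1 t - t * normalTail t)))
    (fun t => by
      refine ((((hasDerivAt_pow 2 t).const_add 1).mul (hasDerivAt_normalTail t)).sub
        ((hasDerivAt_id t).mul (hasDerivAt_stdPDF t))).congr_deriv ?_
      simp; ring)
    (fun t => by have := mul_normalTail_lt_stdPDF t; linarith)
    (by
      have := ((tendsto_pow_mul_normalTail 0).add (tendsto_pow_mul_normalTail 2)).sub
        (tendsto_pow_mul_stdPDF 1)
      simp only [add_zero, sub_zero] at this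
      refine this.congr fun t => by ring) t
  simpa using this

lemma stdPDF_sq_lt (t : ℝ) :
    gaussianPDFReal 0 1 t ^ 2
      < normalTail t ^ 2 + t * gaussianPDFReal 0 1 t * normalTail t := by
  have := pos_of_hasDerivAt_neg
    (f := fun t => normalTail t ^ 2 + t * gaussianPDFReal 0 1 t * normalTail t
      - gaussianPDFReal 0 1 t ^ 2)
    (f' := fun t => -(gaussianPDFReal 0 1 t *
      ((1 + t ^ 2) * normalTail t - t * gaussianPDFReal 0 1 t)))
    (fun t => by
      refine ((((hasDerivAt_normalTail t).pow 2).add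
        (((hasDerivAt_id t).mul (hasDerivAt_stdPDF t)).mul (hasDerivAt_normalTail t))).sub
        ((hasDerivAt_stdPDF t).pow 2)).congr_deriv ?_
      simp; ring)
    (fun t => by
      have := mul_stdPDF_lt t
      have h := mul_pos (stdPDF_pos t) (sub_pos.2 this)
      linarith)
    (by
      have h0 := tendsto_pow_mul_normalTail 0
      have h1 := tendsto_pow_mul_stdPDF 0
      have := ((h0.mul h0).add ((tendsto_pow_mul_stdPDF 1).mul h0)).sub (h1.mul h1)
      simp only [mul_zero, add_zero, sub_zero] at this
      refine this.congr fun t => by ring) t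
  simpa using this

/-- The hazard rate of the standard normal law. -/
noncomputable def hazard (t : ℝ) : ℝ := gaussianPDFReal 0 1 t / normalTail t

/-- The mean excess `E[Z - t | Z > t]` of the standard normal law. -/
noncomputable def meanExcess (t : ℝ) : ℝ := hazard t - t

lemma hazard_pos (t : ℝ) : 0 < hazard t := div_pos (stdPDF_pos t) (normalTail_pos t)

lemma meanExcess_pos (t : ℝ) : 0 < meanExcess t := by
  rw [meanExcess, sub_pos, hazard, lt_div_iff₀ (normalTail_pos t)]
  exact mul_normalTail_lt_stdPDF t

lemma hasDerivAt_hazard (t : ℝ) :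
    HasDerivAt hazard (hazard t * meanExcess t) t := by
  have hN := (normalTail_pos t).ne'
  refine ((hasDerivAt_stdPDF t).div (hasDerivAt_normalTail t) hN).congr_deriv ?_
  simp only [meanExcess, hazard]
  field_simp
  ring

lemma hazard_strictMono : StrictMono hazard :=
  strictMono_of_deriv_pos fun t => by
    rw [(hasDerivAt_hazard t).deriv]; exact mul_pos (hazard_pos t) (meanExcess_pos t)

lemma hazard_mul_meanExcess_lt_one (t : ℝ) : hazard t * meanExcess t < 1 := by
  have hN := normalTail_pos t
  have : hazard t * meanExcess t
      = (gaussianPDFReal 0 1 t ^ 2 - t * gaussianPDFReal 0 1 t * normalTail t)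
        / normalTail t ^ 2 := by
    simp only [meanExcess, hazard]; field_simp
  rw [this, div_lt_one (by positivity)]
  linarith [stdPDF_sq_lt t]

lemma hasDerivAt_meanExcess (t : ℝ) :
    HasDerivAt meanExcess (hazard t * meanExcess t - 1) t :=
  (hasDerivAt_hazard t).sub (hasDerivAt_id t)

lemma meanExcess_strictAnti : StrictAnti meanExcess :=
  strictAnti_of_deriv_neg fun t => by
    rw [(hasDerivAt_meanExcess t).deriv]; linarith [hazard_mul_meanExcess_lt_one t]

lemma meanExcess_lt_inv {t : ℝ} (ht : 0 < t) : meanExcess t < 1 / t := by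
  have hN := normalTail_pos t
  have h := mul_stdPDF_lt t
  rw [meanExcess, sub_lt_iff_lt_add, hazard, div_lt_iff₀ hN, ← mul_lt_mul_iff_right₀ ht]
  refine h.trans_eq ?_
  field_simp

lemma continuous_meanExcess : Continuous meanExcess :=
  continuous_iff_continuousAt.2 fun t => (hasDerivAt_meanExcess t).continuousAt

/-- Intermediate value theorem: the mean excess is below y at 1/y, and above y at −y because the
hazard is positive. -/
lemma exists_meanExcess_eq {y : ℝ} (hy : 0 < y) : ∃ t, meanExcess t = y := by
  have h1 : meanExcess (1 / y) ≤ y := by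
    simpa using (meanExcess_lt_inv (one_div_pos.2 hy)).le
  have h2 : y ≤ meanExcess (-y) := by
    have := hazard_pos (-y); simp only [meanExcess]; linarith
  exact mem_range_of_exists_le_of_exists_ge continuous_meanExcess ⟨_, h1⟩ ⟨_, h2⟩

/-- Solves the stationarity equation in μ. Continuity comes for free, since a strictly monotone
bijection is an order isomorphism; the sign flip in the argument turns the decreasing mean excess
into an increasing map. -/
lemma exists_meanExcess_inverse :
    ∃ τ : ℝ → ℝ, ContinuousOn τ (Set.Ioi 0) ∧ ∀ y, 0 < y → meanExcess (τ y) = y := by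
  let f : ℝ → Set.Ioi (0 : ℝ) := fun t => ⟨meanExcess (-t), meanExcess_pos _⟩
  have hf : StrictMono f := fun a b hab => Subtype.mk_lt_mk.2
    (meanExcess_strictAnti (neg_lt_neg hab))
  have hs : Function.Surjective f := fun y => by
    obtain ⟨t, ht⟩ := exists_meanExcess_eq y.2
    exact ⟨-t, Subtype.ext (by simpa [f] using ht)⟩
  let e := hf.orderIsoOfSurjective f hs
  have he : Continuous e.symm := e.symm.continuous
  classical
  refine ⟨fun y => if hy : 0 < y then -e.symm ⟨y, hy⟩ else 0, ?_, fun y hy => ?_⟩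
  · rw [continuousOn_iff_continuous_domRestrict]
    convert he.neg using 1
    ext ⟨y, hy⟩
    simp [Set.mem_Ioi.1 hy]
  · simp only [hy, dite_true]
    exact congrArg Subtype.val (e.apply_symm_apply ⟨y, hy⟩)

lemma hasDerivAt_log_normalTail (t : ℝ) :
    HasDerivAt (fun t => Real.log (normalTail t)) (-hazard t) t := by
  convert (hasDerivAt_normalTail t).log (normalTail_pos t).ne' using 1
  rw [hazard, neg_div]

lemma concaveOn_log_normalTail :
    ConcaveOn ℝ Set.univ (fun t => Real.log (normalTail t)) := by
  refine Antitone.concaveOn_univ_of_deriv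
    (fun t => (hasDerivAt_log_normalTail t).differentiableAt) fun a b hab => ?_
  rw [(hasDerivAt_log_normalTail a).deriv, (hasDerivAt_log_normalTail b).deriv]
  exact neg_le_neg (hazard_strictMono.monotone hab)

lemma continuous_log_normalTail : Continuous (fun t => Real.log (normalTail t)) :=
  continuous_iff_continuousAt.2 fun t => (hasDerivAt_log_normalTail t).continuousAt

/-- The tangent line of a convex function lies below its graph. -/
lemma convexOn_tangent_le {f : ℝ → ℝ} (hf : ConvexOn ℝ Set.univ f) {f' x : ℝ}
    (hx : HasDerivAt f f' x) (y : ℝ) : f x + f' * (y - x) ≤ f y := by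
  rcases lt_trichotomy x y with h | rfl | h
  · have := hf.le_slope_of_hasDerivAt (Set.mem_univ x) (Set.mem_univ y) h hx
    rw [slope_def_field, le_div_iff₀ (sub_pos.2 h)] at this
    linarith
  · simp
  · have := hf.slope_le_of_hasDerivAt (Set.mem_univ y) (Set.mem_univ x) h hx
    rw [slope_def_field, div_le_iff₀ (sub_pos.2 h)] at this
    linarith

/-- The function on the right has derivative −`meanExcess`, which is increasing, so it is convex and
lies above its tangents. This is the source of the convexity of ψ in μ. -/
lemma log_normalTail_add_sq_tangent (t₀ t : ℝ) :
    Real.log (normalTail t₀) + t₀ ^ 2 / 2 - meanExcess t₀ * (t - t₀)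
      ≤ Real.log (normalTail t) + t ^ 2 / 2 := by
  have hd : ∀ t, HasDerivAt (fun t => Real.log (normalTail t) + t ^ 2 / 2) (-meanExcess t) t := by
    intro t
    refine ((hasDerivAt_log_normalTail t).add ((hasDerivAt_pow 2 t).div_const 2)).congr_deriv ?_
    simp [meanExcess]; ring
  have hc : ConvexOn ℝ Set.univ (fun t => Real.log (normalTail t) + t ^ 2 / 2) := by
    refine Monotone.convexOn_univ_of_deriv (fun t => (hd t).differentiableAt) fun a b hab => ?_
    rw [(hd a).deriv, (hd b).deriv]
    exact neg_le_neg (meanExcess_strictAnti.antitone hab)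
  have := convexOn_tangent_le hc (hd t₀) t
  linarith

end NormalTail

/-! ### Existence of the minimax solution and its saddle-point property -/

section TiltingProgram

variable {n : ℕ} {L : Matrix (Fin n) (Fin n) ℝ} {b : Fin n → ℝ}

lemma mulVec_eq_of_lower (hL : ∀ i j, i < j → L i j = 0) (x : Fin n → ℝ) (k : Fin n) :
    L.mulVec x k = ∑ j ∈ Finset.Iio k, L k j * x j + L k k * x k := by
  have h : ∑ j ∈ Finset.Iic k, L k j * x j = ∑ j, L k j * x j := by
    refine Finset.sum_subset (Finset.subset_univ _) fun j _ hj => ?_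
    rw [hL k j (by simpa using hj), zero_mul]
  rw [Matrix.mulVec, dotProduct, ← h, ← Finset.Iio_insert, Finset.sum_insert (by simp), add_comm]

lemma le_mulVec_iff (hL : ∀ i j, i < j → L i j = 0) (hd : ∀ i, 0 < L i i) (x : Fin n → ℝ)
    (k : Fin n) : b k ≤ L.mulVec x k ↔ seqLower L b x k ≤ x k := by
  rw [mulVec_eq_of_lower hL, seqLower, div_le_iff₀ (hd k), sub_le_iff_le_add, add_comm,
    mul_comm (x k)]

lemma lt_mulVec_iff (hL : ∀ i j, i < j → L i j = 0) (hd : ∀ i, 0 < L i i) (x : Fin n → ℝ)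
    (k : Fin n) : b k < L.mulVec x k ↔ seqLower L b x k < x k := by
  rw [mulVec_eq_of_lower hL, seqLower, div_lt_iff₀ (hd k), sub_lt_iff_lt_add, add_comm,
    mul_comm (x k)]

lemma det_eq_of_lower (hL : ∀ i j, i < j → L i j = 0) : L.det = ∏ i, L i i :=
  Matrix.det_of_isLowerTriangular L fun i j hij => hL i j (OrderDual.toDual_lt_toDual.1 hij)

lemma isUnit_det_of_lower (hL : ∀ i j, i < j → L i j = 0) (hd : ∀ i, 0 < L i i) :
    IsUnit L.det := by
  rw [det_eq_of_lower hL]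
  exact (Finset.prod_pos fun i _ => hd i).ne'.isUnit

lemma continuous_seqLower (k : Fin n) : Continuous fun x => seqLower L b x k := by
  unfold seqLower; fun_prop

lemma psi_eq_sum (x μ : Fin n → ℝ) :
    psi L b x μ = ∑ k, (-(x k * μ k) + μ k ^ 2 / 2
      + Real.log (normalTail (seqLower L b x k - μ k))) := by
  simp only [psi, Finset.sum_add_distrib, Finset.sum_neg_distrib, Finset.sum_div]

lemma continuous_psi :
    Continuous fun z : (Fin n → ℝ) × (Fin n → ℝ) => psi L b z.1 z.2 := by
  simp only [psi_eq_sum]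
  refine continuous_finsetSum _ fun k _ => ?_
  have h1 : Continuous fun z : (Fin n → ℝ) × (Fin n → ℝ) => seqLower L b z.1 k - z.2 k :=
    ((continuous_seqLower k).comp continuous_fst).sub (by fun_prop)
  exact (by fun_prop : Continuous fun z : (Fin n → ℝ) × (Fin n → ℝ) =>
    -(z.1 k * z.2 k) + z.2 k ^ 2 / 2).add (continuous_log_normalTail.comp h1)

lemma hasFDerivAt_psi (x μ : Fin n → ℝ) :
    HasFDerivAt (fun ν => psi L b x ν)
      (∑ k, (meanExcess (seqLower L b x k - μ k) - (x k - seqLower L b x k)) •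
        ContinuousLinearMap.proj (R := ℝ) (φ := fun _ : Fin n => ℝ) k) μ := by
  simp only [psi_eq_sum]
  refine HasFDerivAt.fun_sum fun k _ => ?_
  have h : HasDerivAt (fun t : ℝ => -(x k * t) + t ^ 2 / 2
      + Real.log (normalTail (seqLower L b x k - t)))
      (meanExcess (seqLower L b x k - μ k) - (x k - seqLower L b x k)) (μ k) := by
    refine ((((hasDerivAt_id (μ k)).const_mul (x k)).neg.add
      ((hasDerivAt_pow 2 (μ k)).div_const 2)).add
      ((hasDerivAt_log_normalTail (seqLower L b x k - μ k)).comp (μ k)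
        ((hasDerivAt_id (μ k)).const_sub (seqLower L b x k)))).congr_deriv ?_
    simp [meanExcess]; ring
  exact h.comp_hasFDerivAt μ
    (ContinuousLinearMap.proj (R := ℝ) (φ := fun _ : Fin n => ℝ) k).hasFDerivAt

/-- The gradient in μ decouples over coordinates. Since the mean excess is positive, stationarity
already forces strict feasibility, so the constraint x ∈ C is redundant. -/
lemma mem_tiltingConstraint_iff (hL : ∀ i j, i < j → L i j = 0) (hd : ∀ i, 0 < L i i)
    (x μ : Fin n → ℝ) :
    (x, μ) ∈ tiltingConstraint L b ↔
      ∀ k, meanExcess (seqLower L b x k - μ k) = x k - seqLower L b x k := by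
  constructor
  · rintro ⟨h, -⟩ k
    have := congrArg (fun f : (Fin n → ℝ) →L[ℝ] ℝ => f (Pi.single k 1))
      (h.unique (hasFDerivAt_psi x μ))
    simp [Pi.single_apply] at this
    linarith
  · intro h
    refine ⟨?_, fun k => (le_mulVec_iff hL hd x k).2 ?_⟩
    · simpa [h] using hasFDerivAt_psi (L := L) (b := b) x μ
    · have := meanExcess_pos (seqLower L b x k - μ k)
      have := h k
      linarith

lemma tilting_term_le {a x μ : ℝ} (h : meanExcess (a - μ) = x - a) (ν : ℝ) :
    -(x * μ) + μ ^ 2 / 2 + Real.log (normalTail (a - μ))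
      ≤ -(x * ν) + ν ^ 2 / 2 + Real.log (normalTail (a - ν)) := by
  have := log_normalTail_add_sq_tangent (a - μ) (a - ν)
  rw [h] at this
  linarith

lemma psi_le_of_critical {x μ : Fin n → ℝ}
    (h : ∀ k, meanExcess (seqLower L b x k - μ k) = x k - seqLower L b x k) (ν : Fin n → ℝ) :
    psi L b x μ ≤ psi L b x ν := by
  rw [psi_eq_sum, psi_eq_sum]
  exact Finset.sum_le_sum fun k _ => tilting_term_le (h k) (ν k)

lemma seqLower_segment (x y : Fin n → ℝ) (s : ℝ) (k : Fin n) :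
    seqLower L b ((1 - s) • x + s • y) k
      = (1 - s) * seqLower L b x k + s * seqLower L b y k := by
  simp only [seqLower, Pi.add_apply, Pi.smul_apply, smul_eq_mul, mul_add, Finset.sum_add_distrib]
  have h1 : ∑ j ∈ Finset.Iio k, L k j * ((1 - s) * x j)
      = (1 - s) * ∑ j ∈ Finset.Iio k, L k j * x j := by
    rw [Finset.mul_sum]; exact Finset.sum_congr rfl fun _ _ => by ring
  have h2 : ∑ j ∈ Finset.Iio k, L k j * (s * y j) = s * ∑ j ∈ Finset.Iio k, L k j * y j := by
    rw [Finset.mul_sum]; exact Finset.sum_congr rfl fun _ _ => by ring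
  rw [h1, h2]
  ring

lemma psi_concave (x y μ : Fin n → ℝ) {s : ℝ} (h0 : 0 ≤ s) (h1 : s ≤ 1) :
    (1 - s) * psi L b x μ + s * psi L b y μ ≤ psi L b ((1 - s) • x + s • y) μ := by
  simp only [psi_eq_sum, Finset.mul_sum, ← Finset.sum_add_distrib]
  refine Finset.sum_le_sum fun k _ => ?_
  have := concaveOn_log_normalTail.2 (Set.mem_univ (seqLower L b x k - μ k))
    (Set.mem_univ (seqLower L b y k - μ k)) (sub_nonneg.2 h1) h0 (by ring)
  rw [seqLower_segment]
  simp only [Pi.add_apply, Pi.smul_apply, smul_eq_mul] at this ⊢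
  rw [show (1 - s) * seqLower L b x k + s * seqLower L b y k - μ k
    = (1 - s) * (seqLower L b x k - μ k) + s * (seqLower L b y k - μ k) by ring]
  linarith

lemma exists_seqLower_lt (hL : ∀ i j, i < j → L i j = 0) (hd : ∀ i, 0 < L i i) :
    ∃ x : Fin n → ℝ, ∀ k, seqLower L b x k < x k := by
  refine ⟨L⁻¹.mulVec (b + 1), fun k => (lt_mulVec_iff hL hd _ k).1 ?_⟩
  rw [Matrix.mulVec_mulVec, Matrix.mul_nonsing_inv _ (isUnit_det_of_lower hL hd),
    Matrix.one_mulVec]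
  simp

/-- Test the minimality in μ at ν = x. This gives coercivity of the reduced objective in x. -/
lemma tilting_term_le_sq {a x μ : ℝ} (h : meanExcess (a - μ) = x - a) :
    -(x * μ) + μ ^ 2 / 2 + Real.log (normalTail (a - μ)) ≤ -(x ^ 2 / 2) := by
  have := tilting_term_le h x
  have := log_normalTail_nonpos (a - x)
  nlinarith

/-- Test the minimality in μ at ν = a − T. This acts as a logarithmic barrier: a gap x − a of size
at most 1/T makes the term as low as −log T, which keeps maximizers away from the boundary. -/
lemma tilting_term_le_log {a x μ T R : ℝ} (h : meanExcess (a - μ) = x - a) (hT : 0 < T)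
    (hx : |x| ≤ R) (ha : |a| ≤ R) (hxa : x - a ≤ 1 / T) :
    -(x * μ) + μ ^ 2 / 2 + Real.log (normalTail (a - μ)) ≤ 3 / 2 * R ^ 2 + 1 - Real.log T := by
  have h1 := tilting_term_le h (a - T)
  have h2 : Real.log (normalTail T) ≤ -(T ^ 2 / 2) - Real.log T := by
    rw [← Real.log_exp (-(T ^ 2 / 2)), ← Real.log_div (Real.exp_pos _).ne' hT.ne']
    refine Real.log_le_log (normalTail_pos T) ((normalTail_le_exp T hT).trans ?_)
    rw [show T ^ 2 / 2 - T * T = -(T ^ 2 / 2) by ring]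
    have h3 : 1 ≤ √(2 * Real.pi) := Real.one_le_sqrt.2 (by linarith [Real.pi_gt_three])
    gcongr
    nlinarith
  have h4 : (x - a) * T ≤ 1 := by rwa [← le_div_iff₀ hT]
  have h5 : -(x * a) ≤ R ^ 2 := by
    refine (neg_le_abs _).trans ?_
    rw [abs_mul, sq]
    exact mul_le_mul hx ha (abs_nonneg _) ((abs_nonneg _).trans hx)
  have h6 : a ^ 2 ≤ R ^ 2 := sq_le_sq' (abs_le.1 ha).1 (abs_le.1 ha).2
  rw [sub_sub_cancel] at h1
  linarith

theorem exists_isTiltingSolution (hL : ∀ i j, i < j → L i j = 0) (hd : ∀ i, 0 < L i i) :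
    ∃ x μ : Fin n → ℝ, IsTiltingSolution L b x μ := by
  obtain ⟨τ, hτc, hτ⟩ := exists_meanExcess_inverse
  -- The unique critical μ for a strictly feasible x; the program becomes the maximization of ψ(x; m
  -- x) over the interior of C.
  set m : (Fin n → ℝ) → Fin n → ℝ := fun x k =>
    seqLower L b x k - τ (x k - seqLower L b x k) with hm
  have hcrit : ∀ x : Fin n → ℝ, (∀ k, seqLower L b x k < x k) →
      ∀ k, meanExcess (seqLower L b x k - m x k) = x k - seqLower L b x k := fun x hx k => by
    simp only [hm, sub_sub_cancel]
    exact hτ _ (sub_pos.2 (hx k))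
  obtain ⟨x₀, hx₀⟩ := exists_seqLower_lt (b := b) hL hd
  set c := psi L b x₀ (m x₀) with hc
  -- All terms are nonpositive, so a lower bound on the sum bounds each term from below.
  have hterm : ∀ x : Fin n → ℝ, (∀ k, seqLower L b x k < x k) → c ≤ psi L b x (m x) →
      ∀ k, c ≤ -(x k * m x k) + m x k ^ 2 / 2
        + Real.log (normalTail (seqLower L b x k - m x k)) := fun x hx hcx k => by
    rw [psi_eq_sum, ← Finset.add_sum_erase _ _ (Finset.mem_univ k)] at hcx
    refine hcx.trans (add_le_of_nonpos_right (Finset.sum_nonpos fun j _ => ?_))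
    exact (tilting_term_le_sq (hcrit x hx j)).trans (by simp only [neg_nonpos]; positivity)
  set R := |2 * c| + 1
  have hbox : ∀ x : Fin n → ℝ, (∀ k, seqLower L b x k < x k) → c ≤ psi L b x (m x) →
      ∀ k, |x k| ≤ R := fun x hx hcx k => by
    have h1 := (hterm x hx hcx k).trans (tilting_term_le_sq (hcrit x hx k))
    refine abs_le_of_sq_le_sq (b := R) ?_ (by positivity)
    have := neg_abs_le (2 * c)
    nlinarith [abs_nonneg (2 * c)]
  have hboxc : IsCompact (Set.univ.pi fun _ : Fin n => Set.Icc (-R) R) :=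
    isCompact_univ_pi fun _ => isCompact_Icc
  obtain ⟨R₁, hR₁⟩ := hboxc.exists_bound_of_continuousOn
    (f := fun x => seqLower L b x) (continuous_pi fun k => continuous_seqLower k).continuousOn
  set R₂ := max R R₁
  set T := Real.exp (3 / 2 * R₂ ^ 2 + 2 - c)
  -- With this T the barrier bound equals c − 1, so a gap below 1/T contradicts a value of at least
  -- c. Hence the superlevel set lies in the compact set K, on which the reduced objective is
  -- continuous.
  have hT : 0 < T := Real.exp_pos _
  set K : Set (Fin n → ℝ) := (Set.univ.pi fun _ : Fin n => Set.Icc (-R) R) ∩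
    {x | ∀ k, seqLower L b x k + 1 / T ≤ x k}
  have hK : ∀ x : Fin n → ℝ, (∀ k, seqLower L b x k < x k) → c ≤ psi L b x (m x) → x ∈ K := by
    intro x hx hcx
    have hxb : x ∈ Set.univ.pi fun _ : Fin n => Set.Icc (-R) R :=
      fun k _ => abs_le.1 (hbox x hx hcx k)
    refine ⟨hxb, fun k => ?_⟩
    by_contra! hk
    have h1 := tilting_term_le_log (R := R₂) (hcrit x hx k) hT
      ((hbox x hx hcx k).trans (le_max_left _ _))
      (((norm_le_pi_norm (seqLower L b x) k).trans (hR₁ x hxb)).trans (le_max_right _ _))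
      (by linarith)
    rw [Real.log_exp] at h1
    linarith [hterm x hx hcx k]
  have hKlt : ∀ x ∈ K, ∀ k, seqLower L b x k < x k := fun x hx k => by
    have := hx.2 k
    have := one_div_pos.2 hT
    linarith
  have hKc : IsCompact K := by
    refine hboxc.inter_right ?_
    simp only [Set.ofPred_forall]
    exact isClosed_iInter fun k =>
      isClosed_le ((continuous_seqLower k).add continuous_const) (continuous_apply k)
  have hcont : ContinuousOn (fun x => psi L b x (m x)) K := by
    have hτk : ∀ k, ContinuousOn (fun x : Fin n → ℝ => τ (x k - seqLower L b x k)) K := fun k =>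
      hτc.comp (f := fun x : Fin n → ℝ => x k - seqLower L b x k)
        ((continuous_apply k).sub (continuous_seqLower k)).continuousOn
        fun x hx => sub_pos.2 (hKlt x hx k)
    have hmK : ContinuousOn m K := continuousOn_pi.2 fun k =>
      (continuous_seqLower (L := L) (b := b) k).continuousOn.sub (hτk k)
    exact (continuous_psi (L := L) (b := b)).comp_continuousOn (f := fun x => (x, m x))
      (continuousOn_id.prodMk hmK)
  obtain ⟨x, hxK, hmax⟩ := hKc.exists_isMaxOn ⟨x₀, hK x₀ hx₀ le_rfl⟩ hcont
  refine ⟨x, m x, (mem_tiltingConstraint_iff hL hd _ _).2 (hcrit x (hKlt x hxK)), ?_⟩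
  rintro ⟨y, ν⟩ hy
  have hy' := (mem_tiltingConstraint_iff hL hd _ _).1 hy
  have hylt : ∀ k, seqLower L b y k < y k := fun k => by
    have := meanExcess_pos (seqLower L b y k - ν k)
    have := hy' k
    linarith
  change psi L b y ν ≤ psi L b x (m x)
  refine (psi_le_of_critical hy' (m y)).trans ?_
  by_cases hcy : c ≤ psi L b y (m y)
  · exact hmax (hK y hylt hcy)
  · exact (not_le.1 hcy).le.trans (hmax (hK x₀ hx₀ le_rfl))

/-- The minimax tilting solution is a saddle point of `ψ`. -/
theorem IsTiltingSolution.psi_le (hL : ∀ i j, i < j → L i j = 0) (hd : ∀ i, 0 < L i i)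
    {x μ : Fin n → ℝ} (h : IsTiltingSolution L b x μ) (y : Fin n → ℝ) :
    psi L b y μ ≤ psi L b x μ := by
  obtain ⟨τ, hτc, hτ⟩ := exists_meanExcess_inverse
  have hcrit := (mem_tiltingConstraint_iff hL hd _ _).1 h.1
  -- Move from x towards y along a segment, carrying the critical parameter m s along. Optimality at
  -- X s, concavity in x and minimality of μ at x give ψ(y; m s) ≤ ψ(x; μ) for small s > 0; then s →
  -- 0 and m s → μ.
  set X : ℝ → Fin n → ℝ := fun s => (1 - s) • x + s • y with hX
  set m : ℝ → Fin n → ℝ := fun s k =>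
    seqLower L b (X s) k - τ (X s k - seqLower L b (X s) k) with hm
  have hX0 : X 0 = x := by simp [hX]
  have hXc : Continuous X := by fun_prop
  have hgap : ∀ k, 0 < x k - seqLower L b x k := fun k => by
    rw [← hcrit k]; exact meanExcess_pos _
  have hgapc : ∀ k, Continuous fun s => X s k - seqLower L b (X s) k := fun k =>
    ((continuous_apply k).comp hXc).sub ((continuous_seqLower k).comp hXc)
  have hm0 : m 0 = μ := by
    funext k
    have h1 : meanExcess (τ (x k - seqLower L b x k)) = meanExcess (seqLower L b x k - μ k) := by
      rw [hτ _ (hgap k), hcrit k]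
    simp only [hm, hX0, meanExcess_strictAnti.injective h1, sub_sub_cancel]
  have hmc : ContinuousAt m 0 := by
    refine continuousAt_pi.2 fun k => ?_
    have h1 : ContinuousAt τ (X 0 k - seqLower L b (X 0) k) := by
      rw [hX0]
      exact hτc.continuousAt (Ioi_mem_nhds (hgap k))
    have h2 : ContinuousAt (fun s => τ (X s k - seqLower L b (X s) k)) 0 :=
      ContinuousAt.comp (f := fun s => X s k - seqLower L b (X s) k) h1 (hgapc k).continuousAt
    exact ((continuous_seqLower (L := L) (b := b) k).comp hXc).continuousAt.sub h2
  have hev : ∀ᶠ s in 𝓝[>] (0 : ℝ), psi L b y (m s) ≤ psi L b x μ := by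
    have h1 : ∀ᶠ s in 𝓝[>] (0 : ℝ), ∀ k, 0 < X s k - seqLower L b (X s) k := by
      refine nhdsWithin_le_nhds (eventually_all.2 fun k => ?_)
      refine (hgapc k).continuousAt.eventually (lt_mem_nhds ?_)
      simpa only [hX0] using hgap k
    filter_upwards [h1, self_mem_nhdsWithin, nhdsWithin_le_nhds (Iio_mem_nhds one_pos)]
      with s hs (hs0 : 0 < s) (hs1 : s < 1)
    have hc : (X s, m s) ∈ tiltingConstraint L b :=
      (mem_tiltingConstraint_iff hL hd _ _).2 fun k => by
        simp only [hm, sub_sub_cancel]; exact hτ _ (hs k)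
    have h2 : psi L b (X s) (m s) ≤ psi L b x μ := h.2 hc
    have h3 := psi_le_of_critical hcrit (m s)
    have h4 := psi_concave (L := L) (b := b) x y (m s) hs0.le hs1.le
    have h5 : s * psi L b y (m s) ≤ s * psi L b x μ := by
      nlinarith [mul_le_mul_of_nonneg_left h3 (sub_nonneg.2 hs1.le)]
    exact le_of_mul_le_mul_left h5 hs0
  have hlim : Tendsto (fun s => psi L b y (m s)) (𝓝[>] 0) (𝓝 (psi L b y μ)) := by
    have hψ : Continuous fun ν => psi L b y ν :=
      continuous_psi.comp (f := fun ν => (y, ν)) (by fun_prop)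
    rw [← hm0]
    exact (hψ.tendsto (m 0)).comp (hmc.tendsto.mono_left nhdsWithin_le_nhds)
  exact le_of_tendsto hlim hev

end TiltingProgram

/-! ### Iterated integration of sequential products -/

section Sequential

open scoped ENNReal

/-- Iterated integration of a product whose `k`-th factor depends on the first `k` variables
only, and has constant integral in its last variable. -/
lemma lintegral_prod_sequential {n : ℕ} (F : Fin n → (Fin n → ℝ) → ℝ≥0∞) (c : Fin n → ℝ≥0∞)
    (hm : ∀ k, Measurable (F k))
    (hdep : ∀ k x y, (∀ j ≤ k, x j = y j) → F k x = F k y)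
    (hint : ∀ k x, ∫⁻ t, F k (Function.update x k t) = c k) :
    ∫⁻ x, ∏ k, F k x = ∏ k, c k := by
  induction n with
  | zero =>
    have h : (volume : Measure (Fin 0 → ℝ)) Set.univ = 1 := by
      rw [volume_pi, Measure.pi_univ]; simp
    simp [h]
  | succ n ih =>
    -- Only the last factor sees the last variable, so that variable is integrated out first; the
    -- value 0 is a dummy for the earlier factors.
    have hsnoc : ∀ (y : Fin n → ℝ) (t : ℝ) (k : Fin n),
        F k.castSucc (Fin.snoc y t : Fin (n + 1) → ℝ)
          = F k.castSucc (Fin.snoc y 0 : Fin (n + 1) → ℝ) := fun y t k => by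
      refine hdep _ _ _ fun j hj => ?_
      have hj' : j ≠ Fin.last n := fun h => by
        subst h; exact absurd hj (not_le.2 (Fin.castSucc_lt_last k))
      obtain ⟨i, rfl⟩ := Fin.exists_castSucc_eq.2 hj'
      simp
    have hsm : Measurable fun z : ℝ × (Fin n → ℝ) => (Fin.snoc z.2 z.1 : Fin (n + 1) → ℝ) := by
      refine measurable_pi_iff.2 fun i => ?_
      refine Fin.lastCases ?_ (fun j => ?_) i
      · simpa using measurable_fst
      · simpa [Function.comp_def] using (measurable_pi_apply j).comp measurable_snd
    have hs0 : Measurable fun y : Fin n → ℝ => (Fin.snoc y (0 : ℝ) : Fin (n + 1) → ℝ) :=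
      hsm.comp (measurable_const.prodMk measurable_id)
    have he := (volume_preserving_piFinSuccAbove (fun _ : Fin (n + 1) => ℝ) (Fin.last n)).symm
    rw [← he.lintegral_comp (Finset.measurable_fun_prod _ fun k _ => hm k)]
    have hesymm : ∀ z : ℝ × (Fin n → ℝ),
        (MeasurableEquiv.piFinSuccAbove (fun _ : Fin (n + 1) => ℝ) (Fin.last n)).symm z
          = (Fin.snoc z.2 z.1 : Fin (n + 1) → ℝ) := fun z => by
      simp [MeasurableEquiv.piFinSuccAbove]; rfl
    simp only [hesymm]
    have hmeas : Measurable fun z : ℝ × (Fin n → ℝ) =>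
        ∏ k, F k (Fin.snoc z.2 z.1 : Fin (n + 1) → ℝ) :=
      Finset.measurable_fun_prod _ fun k _ => (hm k).comp hsm
    rw [show (volume : Measure (ℝ × (Fin n → ℝ))) = volume.prod volume from rfl,
      lintegral_prod_symm _ hmeas.aemeasurable]
    have hinner : ∀ y : Fin n → ℝ, ∫⁻ t, ∏ k, F k (Fin.snoc y t : Fin (n + 1) → ℝ)
        = (∏ k : Fin n, F k.castSucc (Fin.snoc y 0 : Fin (n + 1) → ℝ)) * c (Fin.last n) :=
      fun y => by
        simp only [Fin.prod_univ_castSucc, hsnoc y]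
        rw [lintegral_const_mul]
        · congr 1
          rw [← hint (Fin.last n) (Fin.snoc y 0 : Fin (n + 1) → ℝ)]
          refine lintegral_congr fun t => ?_
          rw [Fin.update_snoc_last]
        · exact (hm _).comp (hsm.comp (measurable_id.prodMk measurable_const))
    simp only [hinner]
    have hm0 : ∀ k : Fin n, Measurable fun y : Fin n → ℝ =>
        F k.castSucc (Fin.snoc y 0 : Fin (n + 1) → ℝ) := fun k => (hm _).comp hs0
    rw [lintegral_mul_const _ (Finset.measurable_fun_prod _ fun k _ => hm0 k),
      Fin.prod_univ_castSucc]
    congr 1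
    refine ih (fun k y => F k.castSucc (Fin.snoc y 0 : Fin (n + 1) → ℝ)) _
      hm0 (fun k x y hxy => hdep _ _ _ fun j hj => ?_) fun k y => ?_
    · refine Fin.lastCases (fun _ => by simp) (fun i hi => ?_) j hj
      simpa using hxy i (by simpa using hi)
    · rw [← hint k.castSucc (Fin.snoc y 0 : Fin (n + 1) → ℝ)]
      refine lintegral_congr fun t => ?_
      rw [Fin.snoc_update]

lemma lintegral_prod_eq_prod {n : ℕ} (f : Fin n → ℝ → ℝ≥0∞) (hf : ∀ k, Measurable (f k)) :
    ∫⁻ x : Fin n → ℝ, ∏ k, f k (x k) = ∏ k, ∫⁻ t, f k t :=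
  lintegral_prod_sequential (fun k x => f k (x k)) _
    (fun k => (hf k).comp (measurable_pi_apply k)) (fun k x y h => by rw [h k le_rfl])
    fun k x => by simp

lemma pi_gaussianReal_eq_withDensity (n : ℕ) :
    Measure.pi (fun _ : Fin n => gaussianReal 0 1)
      = volume.withDensity fun x : Fin n → ℝ => ∏ k, gaussianPDF 0 1 (x k) := by
  refine (Measure.pi_eq fun s hs => ?_)
  rw [withDensity_apply _ (MeasurableSet.univ_pi hs),
    ← lintegral_indicator (MeasurableSet.univ_pi hs)]
  have h : ∀ x : Fin n → ℝ, (Set.univ.pi s).indicator (fun x => ∏ k, gaussianPDF 0 1 (x k)) x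
      = ∏ k, (s k).indicator (gaussianPDF 0 1) (x k) := fun x => by
    by_cases hx : x ∈ Set.univ.pi s
    · rw [Set.indicator_of_mem hx]
      exact Finset.prod_congr rfl fun k _ => (Set.indicator_of_mem (hx k trivial) _).symm
    · rw [Set.indicator_of_notMem hx]
      simp only [Set.mem_univ_pi, not_forall] at hx
      obtain ⟨k, hk⟩ := hx
      exact (Finset.prod_eq_zero (Finset.mem_univ k) (Set.indicator_of_notMem hk _)).symm
  simp only [h]
  rw [lintegral_prod_eq_prod (fun k => (s k).indicator (gaussianPDF 0 1))
    fun k => (measurable_gaussianPDF 0 1).indicator (hs k)]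
  refine Finset.prod_congr rfl fun k _ => ?_
  rw [lintegral_indicator (hs k), gaussianReal_apply 0 one_ne_zero]

end Sequential

/-! ### The sampling law, unbiasedness and the variance bound -/

section TiltedLaw

variable {n : ℕ} {L : Matrix (Fin n) (Fin n) ℝ} {b : Fin n → ℝ}

lemma gaussianReal_Ici_eq (a μ : ℝ) :
    gaussianReal μ 1 (Set.Ici a) = ENNReal.ofReal (normalTail (a - μ)) := by
  have h := gaussianReal_map_add_const (μ := 0) (v := 1) μ
  rw [zero_add] at h
  have := nullSingletonClass_gaussianReal (μ := 0) (v := 1) one_ne_zero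
  rw [← h, Measure.map_apply (by fun_prop) measurableSet_Ici, normalTail, ofReal_measureReal]
  simp only [Set.preimage_add_const_Ici]
  exact (measure_congr Ioi_ae_eq_Ici).symm

lemma measurable_tilting_factor (μ : Fin n → ℝ) (k : Fin n) :
    Measurable fun x : Fin n → ℝ =>
      Set.indicator (Set.Ici (seqLower L b x k)) (gaussianPDFReal (μ k) 1) (x k)
        / normalTail (seqLower L b x k - μ k) := by
  have hs : Measurable fun x => seqLower L b x k := (continuous_seqLower k).measurable
  refine Measurable.div ?_ (continuous_normalTail.measurable.comp (hs.sub_const _))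
  have : (fun x : Fin n → ℝ =>
      Set.indicator (Set.Ici (seqLower L b x k)) (gaussianPDFReal (μ k) 1) (x k))
      = {x : Fin n → ℝ | seqLower L b x k ≤ x k}.indicator
          fun x => gaussianPDFReal (μ k) 1 (x k) := by
    ext x; simp [Set.indicator]
  rw [this]
  exact ((measurable_gaussianPDFReal _ _).comp (measurable_pi_apply k)).indicator
    (measurableSet_le hs (measurable_pi_apply k))

lemma tilting_factor_nonneg (μ x : Fin n → ℝ) (k : Fin n) :
    0 ≤ Set.indicator (Set.Ici (seqLower L b x k)) (gaussianPDFReal (μ k) 1) (x k)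
        / normalTail (seqLower L b x k - μ k) :=
  div_nonneg (Set.indicator_nonneg (fun _ _ => gaussianPDFReal_nonneg _ _ _) _)
    (normalTail_pos _).le

lemma seqLower_congr {x y : Fin n → ℝ} {k : Fin n} (h : ∀ j < k, x j = y j) :
    seqLower L b x k = seqLower L b y k := by
  rw [seqLower, seqLower, Finset.sum_congr rfl fun j hj => by rw [h j (Finset.mem_Iio.1 hj)]]

lemma measurable_tiltedDensity (μ : Fin n → ℝ) : Measurable (tiltedDensity L b μ) :=
  Finset.measurable_fun_prod _ fun k _ => measurable_tilting_factor μ k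

lemma tiltedDensity_nonneg (μ x : Fin n → ℝ) : 0 ≤ tiltedDensity L b μ x :=
  Finset.prod_nonneg fun k _ => tilting_factor_nonneg μ x k

/-- Given the earlier coordinates, each factor is a truncated normal density in its own coordinate,
with integral 1. -/
instance isProbabilityMeasure_tiltedMeasure (μ : Fin n → ℝ) :
    IsProbabilityMeasure (tiltedMeasure L b μ) := by
  refine ⟨?_⟩
  rw [tiltedMeasure, withDensity_apply _ MeasurableSet.univ, Measure.restrict_univ]
  simp only [tiltedDensity, ENNReal.ofReal_prod_of_nonneg fun k _ => tilting_factor_nonneg μ _ k]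
  rw [lintegral_prod_sequential _ (fun _ => 1)
    (fun k => (measurable_tilting_factor μ k).ennreal_ofReal) ?_ ?_]
  · simp
  · intro k x y h
    simp only [seqLower_congr (L := L) (b := b) fun j hj => h j (le_of_lt hj), h k le_rfl]
  · intro k x
    have h1 : ∀ t, seqLower L b (Function.update x k t) k = seqLower L b x k := fun t =>
      seqLower_congr fun j hj => Function.update_of_ne hj.ne _ _
    simp only [h1, Function.update_self]
    have h2 : ∀ t, ENNReal.ofReal (Set.indicator (Set.Ici (seqLower L b x k))
        (gaussianPDFReal (μ k) 1) t / normalTail (seqLower L b x k - μ k))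
        = (Set.Ici (seqLower L b x k)).indicator (gaussianPDF (μ k) 1) t
          * (ENNReal.ofReal (normalTail (seqLower L b x k - μ k)))⁻¹ := fun t => by
      rw [ENNReal.ofReal_div_of_pos (normalTail_pos _), div_eq_mul_inv]
      congr 1
      by_cases ht : t ∈ Set.Ici (seqLower L b x k) <;> simp [ht, gaussianPDF]
    simp only [h2]
    rw [lintegral_mul_const _ ((measurable_gaussianPDF _ _).indicator measurableSet_Ici),
      lintegral_indicator measurableSet_Ici, ← gaussianReal_apply _ one_ne_zero,
      gaussianReal_Ici_eq, ENNReal.mul_inv_cancel]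
    · simpa using normalTail_pos _
    · exact ENNReal.ofReal_ne_top

lemma measurableSet_feasible : MeasurableSet (feasible L b) := by
  simp only [feasible, Set.ofPred_forall]
  refine MeasurableSet.iInter fun i => measurableSet_le measurable_const ?_
  have h : Continuous fun x : Fin n → ℝ => L.mulVec x := by fun_prop
  exact ((continuous_apply i).comp h).measurable

lemma tilting_factor_mul_exp (a μ x : ℝ) :
    Set.indicator (Set.Ici a) (gaussianPDFReal μ 1) x / normalTail (a - μ)
        * Real.exp (-(x * μ) + μ ^ 2 / 2 + Real.log (normalTail (a - μ)))
      = Set.indicator (Set.Ici a) (gaussianPDFReal 0 1) x := by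
  by_cases hx : x ∈ Set.Ici a
  · have hN := normalTail_pos (a - μ)
    rw [Set.indicator_of_mem hx, Set.indicator_of_mem hx, Real.exp_add, Real.exp_log hN, stdPDF_eq]
    simp only [gaussianPDFReal, NNReal.coe_one, mul_one]
    have h : Real.exp (-x ^ 2 / 2)
        = Real.exp (-(x - μ) ^ 2 / 2) * Real.exp (-(x * μ) + μ ^ 2 / 2) := by
      rw [← Real.exp_add]; ring_nf
    rw [h]
    field_simp
  · simp [Set.indicator_of_notMem hx]

/-- exp ψ is the likelihood ratio of the standard Gaussian restricted to C against the tilted law: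
for triangular L the sequential truncations together describe exactly C. -/
lemma tiltedDensity_mul_exp_psi (hL : ∀ i j, i < j → L i j = 0) (hd : ∀ i, 0 < L i i)
    (μ x : Fin n → ℝ) :
    tiltedDensity L b μ x * Real.exp (psi L b x μ)
      = (feasible L b).indicator (fun x => ∏ k, gaussianPDFReal 0 1 (x k)) x := by
  rw [psi_eq_sum, Real.exp_sum, tiltedDensity, ← Finset.prod_mul_distrib]
  simp only [tilting_factor_mul_exp]
  by_cases hx : x ∈ feasible L b
  · rw [Set.indicator_of_mem hx]
    exact Finset.prod_congr rfl fun k _ =>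
      Set.indicator_of_mem ((le_mulVec_iff hL hd x k).1 (hx k)) _
  · rw [Set.indicator_of_notMem hx]
    simp only [feasible, Set.mem_ofPred_eq, not_forall] at hx
    obtain ⟨k, hk⟩ := hx
    refine Finset.prod_eq_zero (Finset.mem_univ k) (Set.indicator_of_notMem ?_ _)
    exact fun h => hk ((le_mulVec_iff hL hd x k).2 h)

lemma continuous_exp_psi (μ : Fin n → ℝ) : Continuous fun x => Real.exp (psi L b x μ) :=
  Real.continuous_exp.comp (continuous_psi.comp (continuous_id.prodMk continuous_const))

/-- The importance sampling estimator is unbiased. -/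
lemma integral_exp_psi (hL : ∀ i j, i < j → L i j = 0) (hd : ∀ i, 0 < L i i) (μ : Fin n → ℝ) :
    ∫ x, Real.exp (psi L b x μ) ∂tiltedMeasure L b μ
      = (Measure.pi fun _ : Fin n => gaussianReal 0 1).real (feasible L b) := by
  rw [integral_eq_lintegral_of_nonneg_ae (ae_of_all _ fun x => (Real.exp_pos _).le)
    (continuous_exp_psi μ).aestronglyMeasurable, measureReal_def, tiltedMeasure,
    lintegral_withDensity_eq_lintegral_mul _ (measurable_tiltedDensity μ).ennreal_ofReal
      (continuous_exp_psi μ).measurable.ennreal_ofReal, pi_gaussianReal_eq_withDensity,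
    withDensity_apply _ measurableSet_feasible, ← lintegral_indicator measurableSet_feasible]
  congr 1
  refine lintegral_congr fun x => ?_
  rw [Pi.mul_apply, ← ENNReal.ofReal_mul (tiltedDensity_nonneg μ x),
    tiltedDensity_mul_exp_psi hL hd]
  by_cases hx : x ∈ feasible L b
  · rw [Set.indicator_of_mem hx, Set.indicator_of_mem hx,
      ENNReal.ofReal_prod_of_nonneg fun k _ => gaussianPDFReal_nonneg _ _ _]
    rfl
  · simp [Set.indicator_of_notMem hx]

/-- Bound on the relative variance by the worst-case likelihood ratio. -/
lemma relVariance_le (hL : ∀ i j, i < j → L i j = 0) (hd : ∀ i, 0 < L i i) {μ : Fin n → ℝ}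
    {M : ℝ} (hM : ∀ x, Real.exp (psi L b x μ) ≤ M)
    (hpos : 0 < (Measure.pi fun _ : Fin n => gaussianReal 0 1).real (feasible L b)) :
    relVariance L b μ ((Measure.pi fun _ : Fin n => gaussianReal 0 1).real (feasible L b))
      ≤ ENNReal.ofReal
        (M / (Measure.pi fun _ : Fin n => gaussianReal 0 1).real (feasible L b) - 1) := by
  set ell := (Measure.pi fun _ : Fin n => gaussianReal 0 1).real (feasible L b)
  have hb : ∀ p, MemLp (fun x => Real.exp (psi L b x μ)) p (tiltedMeasure L b μ) := fun p =>
    MemLp.of_bound (continuous_exp_psi μ).aestronglyMeasurable M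
      (ae_of_all _ fun x => by rw [Real.norm_eq_abs, Real.abs_exp]; exact hM x)
  have hmean : ∫ x, Real.exp (psi L b x μ) ∂tiltedMeasure L b μ = ell :=
    integral_exp_psi hL hd μ
  have hvar : variance (fun x => Real.exp (psi L b x μ)) (tiltedMeasure L b μ)
      ≤ M * ell - ell ^ 2 := by
    rw [variance_eq_sub (hb 2), hmean]
    gcongr
    rw [← hmean, ← integral_const_mul]
    refine integral_mono (hb 2).integrable_sq (((hb 1).integrable le_rfl).const_mul M) fun x => ?_
    simp only [Pi.pow_apply, sq]
    exact mul_le_mul_of_nonneg_right (hM x) (Real.exp_pos _).le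
  rw [relVariance, ← (hb 2).ofReal_variance_eq, ← ENNReal.ofReal_div_of_pos (by positivity)]
  refine ENNReal.ofReal_le_ofReal ?_
  rw [div_le_iff₀ (by positivity)]
  refine hvar.trans_eq ?_
  field_simp

end TiltedLaw

/-! ### Reduction of N(0, S) to independent standard normals -/

section GaussianLaw

open Matrix

/-- Both laws are Gaussian, hence determined by mean and covariance. -/
lemma map_stdGaussian_toEuclideanCLM {ι : Type*} [Fintype ι] [DecidableEq ι] {B S : Matrix ι ι ℝ}
    (hS : S.PosSemidef) (hB : B * B.transpose = S) :
    (stdGaussian (EuclideanSpace ℝ ι)).map (toEuclideanCLM (𝕜 := ℝ) B)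
      = multivariateGaussian 0 S := by
  refine IsGaussian.ext ?_ ?_
  · rw [integral_id_multivariateGaussian']
    simp only [id]
    rw [ContinuousLinearMap.integral_id_map IsGaussian.integrable_id]
    simp
  · ext x y
    have hadj : (toEuclideanCLM (𝕜 := ℝ) B).adjoint = toEuclideanCLM (𝕜 := ℝ) B.transpose := by
      rw [← ContinuousLinearMap.star_eq_adjoint, ← map_star, star_eq_conjTranspose,
        conjTranspose_eq_transpose_of_trivial]
    rw [covarianceBilin_multivariateGaussian hS,
      covarianceBilin_map IsGaussian.memLp_two_id, covarianceBilin_stdGaussian,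
      innerSL_apply_apply, ContinuousLinearMap.adjoint_inner_left, hadj, inner_toEuclideanCLM,
      ofLp_toEuclideanCLM, mulVec_mulVec, hB]

variable {n : ℕ}

lemma stdGaussian_real_eq (L : Matrix (Fin n) (Fin n) ℝ) (b : Fin n → ℝ) :
    (multivariateGaussian (0 : EuclideanSpace ℝ (Fin n)) 1).real
        {z | ∀ i, b i ≤ (L.mulVec z.ofLp) i}
      = (Measure.pi fun _ : Fin n => gaussianReal 0 1).real (feasible L b) := by
  rw [multivariateGaussian_zero_one, ← map_pi_eq_stdGaussian,
    map_measureReal_apply (by fun_prop)]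
  · rfl
  · exact (measurableSet_feasible (L := L) (b := b)).preimage
      (WithLp.measurable_ofLp 2 (Fin n → ℝ))

lemma multivariateGaussian_real_eq {S L : Matrix (Fin n) (Fin n) ℝ} (hS : S.PosSemidef)
    (σ : Equiv.Perm (Fin n)) (hL : L * L.transpose = S.submatrix σ σ) (b : Fin n → ℝ) :
    (multivariateGaussian (0 : EuclideanSpace ℝ (Fin n)) S).real {x | ∀ i, b i ≤ x i}
      = (multivariateGaussian (0 : EuclideanSpace ℝ (Fin n)) 1).real
        {z | ∀ i, b (σ i) ≤ (L.mulVec z.ofLp) i} := by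
  -- Permuting the rows of L back gives a square root of S itself, whose row σ i is row i of L.
  have hB : (L.submatrix σ.symm id) * (L.submatrix σ.symm id).transpose = S := by
    rw [transpose_submatrix, ← submatrix_mul _ _ _ id _ Function.bijective_id, hL]
    simp
  rw [multivariateGaussian_zero_one, ← map_stdGaussian_toEuclideanCLM hS hB,
    map_measureReal_apply (by fun_prop)]
  · congr 1
    ext z
    simp only [Set.mem_preimage, Set.mem_ofPred_eq]
    rw [← σ.forall_congr_right]
    refine forall_congr' fun i => ?_
    rw [show (toEuclideanCLM (𝕜 := ℝ) (L.submatrix σ.symm id) z) (σ i)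
      = (L.submatrix σ.symm id).mulVec z.ofLp (σ i) from rfl]
    simp [mulVec]
  · simp only [Set.ofPred_forall]
    exact MeasurableSet.iInter fun i => measurableSet_le measurable_const (by fun_prop)

end GaussianLaw

/-! ### KKT identities and the upper bound on the likelihood ratio -/

section Asymptotics

open scoped ENNReal

variable {n : ℕ} {L : Matrix (Fin n) (Fin n) ℝ} {p x lam : Fin n → ℝ}

/-- The exponential asymptotics of the Gaussian tail probability of `{L z ≥ γ p}`, up to a
constant, where `x` minimises `‖x‖²` over `{L x ≥ p}` and `lam` is its multiplier. -/
noncomputable def tailScale (L : Matrix (Fin n) (Fin n) ℝ) (x lam : Fin n → ℝ) (γ : ℝ) : ℝ :=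
  Real.exp (-(γ ^ 2 * ∑ k, x k ^ 2 / 2)) *
    ∏ k, if 0 < lam k then (√(2 * Real.pi) * (γ * (L k k * lam k)))⁻¹ else 1

lemma tailScale_pos (hd : ∀ i, 0 < L i i) {γ : ℝ} (hγ : 0 < γ) : 0 < tailScale L x lam γ := by
  refine mul_pos (Real.exp_pos _) (Finset.prod_pos fun k _ => ?_)
  split_ifs with h
  · have := hd k
    positivity
  · exact one_pos

lemma IsKKT.eq_transpose (h : IsKKT L p x lam) : x = L.transpose.mulVec lam :=
  sub_eq_zero.1 h.stationary

lemma IsKKT.sum_mul (h : IsKKT L p x lam) (y : Fin n → ℝ) :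
    ∑ k, x k * y k = ∑ k, lam k * L.mulVec y k := by
  change x ⬝ᵥ y = lam ⬝ᵥ L.mulVec y
  rw [Matrix.dotProduct_mulVec, ← Matrix.mulVec_transpose, ← h.eq_transpose]

/-- All summands in the complementarity condition are nonpositive, so each vanishes. -/
lemma IsKKT.mul_mulVec (h : IsKKT L p x lam) (k : Fin n) :
    lam k * L.mulVec x k = lam k * p k := by
  have h1 := (Finset.sum_eq_zero_iff_of_nonpos fun i _ =>
    mul_nonpos_of_nonneg_of_nonpos (h.dual_nonneg i) (h.primal_feasible i)).1 h.complementary k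
    (Finset.mem_univ k)
  linarith

lemma IsKKT.sum_sq (h : IsKKT L p x lam) : ∑ k, lam k * p k = ∑ k, x k ^ 2 := by
  simp only [sq, h.sum_mul x, h.mul_mulVec]

/-- At the asymptotically optimal tilting parameter the likelihood ratio is uniformly bounded. -/
lemma IsKKT.exp_psi_le (hL : ∀ i j, i < j → L i j = 0) (hd : ∀ i, 0 < L i i)
    (h : IsKKT L p x lam) {γ : ℝ} (hγ : 0 < γ) (y : Fin n → ℝ) :
    Real.exp (psi L (γ • p) y (fun k => γ * (x k - L k k * lam k))) ≤ tailScale L x lam γ := by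
  -- For active k the tail is bounded by its exponential tangent at slope γ L_kk λ_k, for inactive k
  -- by 1. This slope cancels the triangular remainder in `seqLower`, leaving x_k y_k and λ_k (L
  -- y)_k, whose sums agree because x = Lᵀλ; thus the dependence on y disappears.
  have hterm : ∀ k, -(y k * (γ * (x k - L k k * lam k)))
      + (γ * (x k - L k k * lam k)) ^ 2 / 2
      + Real.log (normalTail (seqLower L (γ • p) y k - γ * (x k - L k k * lam k)))
      ≤ (γ ^ 2 * (x k ^ 2 / 2) - γ * (y k * x k) - γ ^ 2 * (lam k * p k)
          + γ * (lam k * L.mulVec y k))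
        + Real.log (if 0 < lam k then (√(2 * Real.pi) * (γ * (L k k * lam k)))⁻¹ else 1) := by
    intro k
    have hLk := hd k
    have ha : L k k * seqLower L (γ • p) y k = γ * p k - (L.mulVec y k - L k k * y k) := by
      rw [mulVec_eq_of_lower hL, seqLower, Pi.smul_apply, smul_eq_mul]
      field_simp
      ring
    have hlog : Real.log (normalTail (seqLower L (γ • p) y k - γ * (x k - L k k * lam k)))
        ≤ (γ * (L k k * lam k)) ^ 2 / 2 - γ * (L k k * lam k) *
            (seqLower L (γ • p) y k - γ * (x k - L k k * lam k))
          + Real.log (if 0 < lam k then (√(2 * Real.pi) * (γ * (L k k * lam k)))⁻¹ else 1) := by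
      split_ifs with hk
      · have hs : 0 < γ * (L k k * lam k) := by positivity
        have h1 := Real.log_le_log (normalTail_pos _) (normalTail_le_exp
          (seqLower L (γ • p) y k - γ * (x k - L k k * lam k)) hs)
        rw [Real.log_div (Real.exp_pos _).ne' (by positivity), Real.log_exp] at h1
        rwa [Real.log_inv, ← sub_eq_add_neg]
      · have : lam k = 0 := le_antisymm (not_lt.1 hk) (h.dual_nonneg k)
        simpa [this] using log_normalTail_nonpos _
    have hmul : γ * (L k k * lam k) * seqLower L (γ • p) y k
        = γ * lam k * (γ * p k - (L.mulVec y k - L k k * y k)) := by rw [← ha]; ring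
    nlinarith
  have hsum : ∑ k, (γ ^ 2 * (x k ^ 2 / 2) - γ * (y k * x k) - γ ^ 2 * (lam k * p k)
      + γ * (lam k * L.mulVec y k)) = -(γ ^ 2 * ∑ k, x k ^ 2 / 2) := by
    rw [Finset.sum_add_distrib, Finset.sum_sub_distrib, Finset.sum_sub_distrib,
      ← Finset.mul_sum, ← Finset.mul_sum, ← Finset.mul_sum, ← Finset.mul_sum, h.sum_sq,
      ← h.sum_mul, ← Finset.sum_div, Finset.sum_congr rfl fun k _ => mul_comm (y k) (x k)]
    ring
  have hβ : ∀ k, 0 < if 0 < lam k then (√(2 * Real.pi) * (γ * (L k k * lam k)))⁻¹ else 1 := by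
    intro k
    split_ifs with hk
    · have := hd k
      positivity
    · exact one_pos
  rw [psi_eq_sum, tailScale, ← Finset.prod_congr rfl fun k _ => Real.exp_log (hβ k),
    ← Real.exp_sum, ← Real.exp_add, ← hsum, ← Finset.sum_add_distrib]
  exact Real.exp_le_exp.2 (Finset.sum_le_sum fun k _ => hterm k)

/-- The likelihood ratio of the minimax estimator is bounded by `tailScale`. -/
lemma IsTiltingSolution.exp_psi_le (hL : ∀ i j, i < j → L i j = 0) (hd : ∀ i, 0 < L i i)
    (h : IsKKT L p x lam) {γ : ℝ} (hγ : 0 < γ) {xs μs : Fin n → ℝ}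
    (hs : IsTiltingSolution L (γ • p) xs μs) (y : Fin n → ℝ) :
    Real.exp (psi L (γ • p) y μs) ≤ tailScale L x lam γ :=
  (Real.exp_le_exp.2 ((hs.psi_le hL hd y).trans
    (psi_le_of_critical ((mem_tiltingConstraint_iff hL hd _ _).1 hs.1) _))).trans
    (h.exp_psi_le hL hd hγ xs)

end Asymptotics

/-! ### Local coordinates at the dominating point -/

section LowerBound

open scoped ENNReal

variable {n : ℕ} {L : Matrix (Fin n) (Fin n) ℝ} {p x lam : Fin n → ℝ}

lemma lintegral_affine (M : Matrix (Fin n) (Fin n) ℝ) (hM : M.det ≠ 0) (c : Fin n → ℝ)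
    {f : (Fin n → ℝ) → ℝ≥0∞} (hf : Measurable f) :
    ∫⁻ x, f x = ENNReal.ofReal |M.det| * ∫⁻ w, f (c + M.mulVec w) := by
  have hg : Measurable fun x => f (c + x) := hf.comp (measurable_const_add c)
  have h := lintegral_map (μ := volume) hg
    (LinearMap.continuous_of_finiteDimensional (Matrix.toLin' M)).measurable
  rw [Real.map_matrix_volume_pi_eq_smul_volume_pi hM, lintegral_smul_measure,
    lintegral_add_left_eq_self f c] at h
  simp only [Matrix.toLin'_apply] at h
  rw [← h, smul_eq_mul, ← mul_assoc, ← ENNReal.ofReal_mul (abs_nonneg _), ← abs_mul,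
    mul_inv_cancel₀ hM, abs_one, ENNReal.ofReal_one, one_mul]

/-- The rows of `L` with positive multiplier, completed by unit vectors. -/
noncomputable def activeMatrix (L : Matrix (Fin n) (Fin n) ℝ) (lam : Fin n → ℝ) : Matrix (Fin n) (Fin n) ℝ :=
  Matrix.of fun k j => if 0 < lam k then L k j else if k = j then 1 else 0

/-- Scaling of the local coordinates. -/
noncomputable def activeScale (lam : Fin n → ℝ) (ε : ℝ) (k : Fin n) : ℝ :=
  if 0 < lam k then ε else 1

/-- Local coordinates at the dominating point, with scale `ε` in the directions of the active
constraints. -/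
noncomputable def localMatrix (L : Matrix (Fin n) (Fin n) ℝ) (lam : Fin n → ℝ) (ε : ℝ) :
    Matrix (Fin n) (Fin n) ℝ :=
  (activeMatrix L lam)⁻¹ * Matrix.diagonal (activeScale lam ε)

lemma activeMatrix_lower (hL : ∀ i j, i < j → L i j = 0) :
    ∀ i j, i < j → activeMatrix L lam i j = 0 := fun i j hij => by
  simp [activeMatrix, hL i j hij, hij.ne]

lemma activeMatrix_diag (hd : ∀ i, 0 < L i i) (i : Fin n) : 0 < activeMatrix L lam i i := by
  by_cases h : 0 < lam i <;> simp [activeMatrix, h, hd i]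

lemma activeMatrix_mulVec_of_pos (y : Fin n → ℝ) {k : Fin n} (hk : 0 < lam k) :
    (activeMatrix L lam).mulVec y k = L.mulVec y k := by
  simp [activeMatrix, Matrix.mulVec, dotProduct, hk]

lemma activeMatrix_mulVec_of_not_pos (y : Fin n → ℝ) {k : Fin n} (hk : ¬ 0 < lam k) :
    (activeMatrix L lam).mulVec y k = y k := by
  simp [activeMatrix, Matrix.mulVec, dotProduct, hk]

lemma activeMatrix_mulVec_localMatrix (hL : ∀ i j, i < j → L i j = 0) (hd : ∀ i, 0 < L i i)
    (ε : ℝ) (w : Fin n → ℝ) (k : Fin n) :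
    (activeMatrix L lam).mulVec ((localMatrix L lam ε).mulVec w) k
      = activeScale lam ε k * w k := by
  rw [Matrix.mulVec_mulVec, localMatrix, ← Matrix.mul_assoc, Matrix.mul_nonsing_inv _
    (isUnit_det_of_lower (activeMatrix_lower hL) (activeMatrix_diag hd)), Matrix.one_mul,
    Matrix.mulVec_diagonal]

lemma localMatrix_det (hL : ∀ i j, i < j → L i j = 0) (ε : ℝ) :
    (localMatrix L lam ε).det = ∏ k, activeScale lam ε k / activeMatrix L lam k k := by
  rw [localMatrix, Matrix.det_mul, Matrix.det_nonsing_inv, Matrix.det_diagonal,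
    det_eq_of_lower (activeMatrix_lower hL), Ring.inverse_eq_inv', Finset.prod_div_distrib,
    div_eq_mul_inv, mul_comm]

lemma activeScale_pos {ε : ℝ} (hε : 0 < ε) (k : Fin n) : 0 < activeScale lam ε k := by
  unfold activeScale; split_ifs <;> positivity

lemma localMatrix_det_pos (hL : ∀ i j, i < j → L i j = 0) (hd : ∀ i, 0 < L i i) {ε : ℝ}
    (hε : 0 < ε) : 0 < (localMatrix L lam ε).det := by
  rw [localMatrix_det hL]
  exact Finset.prod_pos fun k _ => div_pos (activeScale_pos hε k) (activeMatrix_diag hd k)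

lemma mulVec_localMatrix_of_pos (hL : ∀ i j, i < j → L i j = 0) (hd : ∀ i, 0 < L i i)
    (ε : ℝ) (w : Fin n → ℝ) {k : Fin n} (hk : 0 < lam k) :
    L.mulVec ((localMatrix L lam ε).mulVec w) k = ε * w k := by
  rw [← activeMatrix_mulVec_of_pos _ hk, activeMatrix_mulVec_localMatrix hL hd, activeScale,
    if_pos hk]

/-- In the limit of vanishing scale, the local coordinates only move the inactive variables. -/
lemma localMatrix_zero_mulVec (hL : ∀ i j, i < j → L i j = 0) (hd : ∀ i, 0 < L i i)
    (hlam : ∀ j k, j ≤ k → 0 < lam k → 0 < lam j) (w : Fin n → ℝ) :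
    (localMatrix L lam 0).mulVec w = fun k => activeScale lam 0 k * w k := by
  have hdet := isUnit_det_of_lower (activeMatrix_lower (lam := lam) hL) (activeMatrix_diag hd)
  have h : (activeMatrix L lam).mulVec (fun k => activeScale lam 0 k * w k)
      = (activeMatrix L lam).mulVec ((localMatrix L lam 0).mulVec w) := by
    funext k
    rw [activeMatrix_mulVec_localMatrix hL hd]
    by_cases hk : 0 < lam k
    · rw [activeMatrix_mulVec_of_pos _ hk]
      simp only [Matrix.mulVec, dotProduct]
      rw [activeScale, if_pos hk, zero_mul]
      refine Finset.sum_eq_zero fun j _ => ?_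
      -- The active indices form an initial segment, so by triangularity an active row only involves
      -- active columns, whose scale is 0.
      rcases le_or_gt j k with hjk | hjk
      · rw [activeScale, if_pos (hlam j k hjk hk)]; ring
      · rw [hL k j hjk, zero_mul]
    · rw [activeMatrix_mulVec_of_not_pos _ hk]
  have := congrArg ((activeMatrix L lam)⁻¹.mulVec) h
  rw [Matrix.mulVec_mulVec, Matrix.mulVec_mulVec, Matrix.nonsing_inv_mul _ hdet,
    Matrix.one_mulVec, Matrix.one_mulVec] at this
  exact this.symm

lemma tendsto_localMatrix_mulVec (w : Fin n → ℝ) :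
    Tendsto (fun γ : ℝ => (localMatrix L lam γ⁻¹).mulVec w) atTop
      (𝓝 ((localMatrix L lam 0).mulVec w)) := by
  have hc : Continuous fun ε : ℝ => (localMatrix L lam ε).mulVec w := by
    have h : Continuous fun ε : ℝ => activeScale lam ε := continuous_pi fun k => by
      unfold activeScale; split_ifs <;> fun_prop
    exact (continuous_const.matrix_mul h.matrix_diagonal).matrix_mulVec continuous_const
  exact (hc.tendsto 0).comp tendsto_inv_atTop_zero

/-- The Gaussian density on the feasible region in local coordinates, rescaled. -/
noncomputable def localDensity (L : Matrix (Fin n) (Fin n) ℝ) (p x lam : Fin n → ℝ) (γ : ℝ)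
    (w : Fin n → ℝ) : ℝ≥0∞ :=
  {w | γ • x + (localMatrix L lam γ⁻¹).mulVec w ∈ feasible L (γ • p)}.indicator
    (fun w => ENNReal.ofReal (Real.exp (-∑ k, lam k * w k
      - ∑ k, (localMatrix L lam γ⁻¹).mulVec w k ^ 2 / 2))) w

lemma measurable_localDensity (γ : ℝ) : Measurable (localDensity L p x lam γ) := by
  have h : Continuous fun w : Fin n → ℝ => (localMatrix L lam γ⁻¹).mulVec w := by fun_prop
  refine Measurable.indicator (Continuous.measurable ?_).ennreal_ofReal
    (measurableSet_feasible.preimage (continuous_const.add h).measurable)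
  have h' := fun k => (continuous_apply k).comp h
  simp only [Function.comp_def] at h'
  fun_prop

lemma prod_gaussianPDF_eq (y : Fin n → ℝ) :
    ∏ k, gaussianPDF 0 1 (y k)
      = ENNReal.ofReal ((∏ _k : Fin n, (√(2 * Real.pi))⁻¹) * Real.exp (-∑ k, y k ^ 2 / 2)) := by
  simp only [gaussianPDF]
  rw [← ENNReal.ofReal_prod_of_nonneg fun k _ => gaussianPDFReal_nonneg _ _ _]
  simp only [stdPDF_eq]
  rw [Finset.prod_mul_distrib, ← Real.exp_sum, ← Finset.sum_neg_distrib]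
  simp only [neg_div]

/-- Normalising constants of the factors of the limiting local density. -/
noncomputable def limitConst (lam : Fin n → ℝ) (k : Fin n) : ℝ :=
  if 0 < lam k then lam k else (√(2 * Real.pi))⁻¹

lemma limitConst_pos (k : Fin n) : 0 < limitConst lam k := by
  unfold limitConst
  split_ifs <;> positivity

lemma measure_feasible_eq (hL : ∀ i j, i < j → L i j = 0) (hd : ∀ i, 0 < L i i)
    (h : IsKKT L p x lam) {γ : ℝ} (hγ : 0 < γ) :
    Measure.pi (fun _ : Fin n => gaussianReal 0 1) (feasible L (γ • p))
      = ENNReal.ofReal (tailScale L x lam γ) *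
        (ENNReal.ofReal (∏ k, limitConst lam k) * ∫⁻ w, localDensity L p x lam γ w) := by
  have hdet := localMatrix_det_pos (lam := lam) hL hd (inv_pos.2 hγ)
  have hmeas : Measurable fun y : Fin n → ℝ => ∏ k, gaussianPDF 0 1 (y k) :=
    Finset.measurable_fun_prod _ fun k _ => (measurable_gaussianPDF 0 1).comp
      (measurable_pi_apply k)
  rw [pi_gaussianReal_eq_withDensity, withDensity_apply _ measurableSet_feasible,
    ← lintegral_indicator measurableSet_feasible,
    lintegral_affine (localMatrix L lam γ⁻¹) hdet.ne' (γ • x)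
      (hmeas.indicator measurableSet_feasible), abs_of_pos hdet]
  have hpt : ∀ w : Fin n → ℝ, (feasible L (γ • p)).indicator
      (fun x => ∏ k, gaussianPDF 0 1 (x k)) (γ • x + (localMatrix L lam γ⁻¹).mulVec w)
      = ENNReal.ofReal ((∏ _k : Fin n, (√(2 * Real.pi))⁻¹)
          * Real.exp (-(γ ^ 2 * ∑ k, x k ^ 2 / 2))) * localDensity L p x lam γ w := by
    intro w
    set y := (localMatrix L lam γ⁻¹).mulVec w with hy
    -- The cross term of the expanded square is linear in the active coordinates only, because x =
    -- Lᵀλ; the factor γ cancels the scale 1/γ.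
    have hcross : γ * ∑ k, x k * y k = ∑ k, lam k * w k := by
      rw [h.sum_mul, Finset.mul_sum]
      refine Finset.sum_congr rfl fun k _ => ?_
      by_cases hk : 0 < lam k
      · rw [hy, mulVec_localMatrix_of_pos hL hd _ _ hk]
        field_simp
      · have : lam k = 0 := le_antisymm (not_lt.1 hk) (h.dual_nonneg k)
        simp [this]
    have hexp : Real.exp (-∑ k, (γ • x + y) k ^ 2 / 2)
        = Real.exp (-(γ ^ 2 * ∑ k, x k ^ 2 / 2))
          * Real.exp (-∑ k, lam k * w k - ∑ k, y k ^ 2 / 2) := by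
      rw [← Real.exp_add, ← hcross]
      congr 1
      simp only [Finset.mul_sum, ← Finset.sum_neg_distrib, ← Finset.sum_sub_distrib,
        ← Finset.sum_add_distrib, Pi.add_apply, Pi.smul_apply, smul_eq_mul]
      exact Finset.sum_congr rfl fun k _ => by ring
    rw [localDensity]
    by_cases hw : γ • x + y ∈ feasible L (γ • p)
    · rw [Set.indicator_of_mem hw, Set.indicator_of_mem (by exact hw), prod_gaussianPDF_eq, hexp,
        ← mul_assoc, ENNReal.ofReal_mul (by positivity)]
    · rw [Set.indicator_of_notMem hw, Set.indicator_of_notMem (by exact hw), mul_zero]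
  simp only [hpt]
  rw [lintegral_const_mul _ (measurable_localDensity γ), ← mul_assoc, ← mul_assoc,
    ← ENNReal.ofReal_mul hdet.le, ← ENNReal.ofReal_mul (tailScale_pos hd hγ).le]
  congr 2
  have hprod : (∏ k, activeScale lam γ⁻¹ k / activeMatrix L lam k k) *
      ∏ _k : Fin n, (√(2 * Real.pi))⁻¹
      = (∏ k, if 0 < lam k then (√(2 * Real.pi) * (γ * (L k k * lam k)))⁻¹ else 1)
        * ∏ k, limitConst lam k := by
    rw [← Finset.prod_mul_distrib, ← Finset.prod_mul_distrib]
    refine Finset.prod_congr rfl fun k _ => ?_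
    have := hd k
    by_cases hk : 0 < lam k
    · simp only [activeScale, activeMatrix, limitConst, Matrix.of_apply, if_pos hk]
      field_simp
    · simp [activeScale, activeMatrix, limitConst, hk]
  rw [localMatrix_det hL, tailScale, ← mul_assoc, hprod]
  ring

end LowerBound

/-! ### Fatou's lemma and the mass of the limiting density -/

section LimitingDensity

open scoped ENNReal

variable {n : ℕ} {L : Matrix (Fin n) (Fin n) ℝ} {p x lam : Fin n → ℝ}

/-- Factors of the limiting local density. -/
noncomputable def limitFactor (lam : Fin n → ℝ) (k : Fin n) (t : ℝ) : ℝ≥0∞ :=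
  if 0 < lam k then (Set.Ici 0).indicator (fun t => ENNReal.ofReal (Real.exp (-(lam k * t)))) t
  else ENNReal.ofReal (Real.exp (-(t ^ 2 / 2)))

lemma measurable_limitFactor (k : Fin n) : Measurable (limitFactor lam k) := by
  by_cases hk : 0 < lam k
  · simp only [funext fun t => show limitFactor lam k t = _ from if_pos hk]
    exact Measurable.indicator (by fun_prop) measurableSet_Ici
  · simp only [funext fun t => show limitFactor lam k t = _ from if_neg hk]
    fun_prop

lemma lintegral_limitFactor (k : Fin n) :
    ∫⁻ t, limitFactor lam k t = ENNReal.ofReal (limitConst lam k)⁻¹ := by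
  by_cases hk : 0 < lam k
  · simp only [funext fun t => show limitFactor lam k t = _ from if_pos hk, limitConst, if_pos hk]
    rw [lintegral_indicator measurableSet_Ici, setLIntegral_congr Ioi_ae_eq_Ici.symm,
      ← ofReal_integral_eq_lintegral_ofReal]
    · have := integral_exp_mul_Ioi (a := -lam k) (by linarith) 0
      simp only [neg_mul, mul_zero, Real.exp_zero] at this
      rw [this]
      congr 1
      field_simp
    · have := integrableOn_exp_mul_Ioi (a := -lam k) (by linarith) 0
      simp only [neg_mul] at this
      exact this
    · exact ae_of_all _ fun t => (Real.exp_pos _).le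
  · simp only [funext fun t => show limitFactor lam k t = _ from if_neg hk, limitConst, if_neg hk,
      inv_inv]
    have h := lintegral_gaussianPDFReal_eq_one 0 (v := 1) one_ne_zero
    simp only [stdPDF_eq, neg_div] at h
    have hpos : 0 < √(2 * Real.pi) := by positivity
    have h2 : ∀ t : ℝ, ENNReal.ofReal ((√(2 * Real.pi))⁻¹ * Real.exp (-(t ^ 2 / 2)))
        = ENNReal.ofReal (√(2 * Real.pi))⁻¹ * ENNReal.ofReal (Real.exp (-(t ^ 2 / 2))) :=
      fun t => ENNReal.ofReal_mul (by positivity)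
    simp only [h2] at h
    rw [lintegral_const_mul _ (by fun_prop), ENNReal.ofReal_inv_of_pos hpos] at h
    rw [mul_comm] at h
    rw [ENNReal.eq_inv_of_mul_eq_one_left h, inv_inv]

/-- Directions in which the inactive constraints that are tight at `x` stay strictly feasible. -/
def tightCone (L : Matrix (Fin n) (Fin n) ℝ) (p x lam : Fin n → ℝ) : Set (Fin n → ℝ) :=
  {w | ∀ k, ¬ 0 < lam k → L.mulVec x k = p k →
    0 < L.mulVec (fun j => activeScale lam 0 j * w j) k}

lemma isOpen_tightCone : IsOpen (tightCone L p x lam) := by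
  have hc : Continuous fun w : Fin n → ℝ => L.mulVec (fun j => activeScale lam 0 j * w j) := by
    fun_prop
  simp only [tightCone, Set.ofPred_forall]
  exact isOpen_iInter_of_finite fun k => isOpen_iInter_of_finite fun _ =>
    isOpen_iInter_of_finite fun _ => isOpen_lt continuous_const ((continuous_apply k).comp hc)

/-- Pointwise lower limit of the local densities. -/
noncomputable def limitDensity (L : Matrix (Fin n) (Fin n) ℝ) (p x lam : Fin n → ℝ)
    (w : Fin n → ℝ) : ℝ≥0∞ :=
  (tightCone L p x lam).indicator (fun w => ∏ k, limitFactor lam k (w k)) w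

lemma prod_limitFactor_eq (hlam : ∀ k, 0 ≤ lam k) {w : Fin n → ℝ} (hw : ∀ k, 0 < lam k → 0 ≤ w k) :
    ∏ k, limitFactor lam k (w k) = ENNReal.ofReal (Real.exp (-∑ k, lam k * w k
      - ∑ k, (activeScale lam 0 k * w k) ^ 2 / 2)) := by
  rw [← Finset.sum_neg_distrib, ← Finset.sum_sub_distrib, Real.exp_sum,
    ENNReal.ofReal_prod_of_nonneg fun k _ => (Real.exp_pos _).le]
  refine Finset.prod_congr rfl fun k _ => ?_
  by_cases hk : 0 < lam k
  · rw [limitFactor, if_pos hk, Set.indicator_of_mem (Set.mem_Ici.2 (hw k hk)), activeScale,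
      if_pos hk]
    simp
  · have : lam k = 0 := le_antisymm (not_lt.1 hk) (hlam k)
    rw [limitFactor, if_neg hk, activeScale, if_neg hk, this]
    simp

lemma limitDensity_le_liminf (hL : ∀ i j, i < j → L i j = 0) (hd : ∀ i, 0 < L i i)
    (h : IsKKT L p x lam) (hlam : ∀ j k, j ≤ k → 0 < lam k → 0 < lam j) (w : Fin n → ℝ) :
    limitDensity L p x lam w ≤ liminf (fun γ : ℝ => localDensity L p x lam γ w) atTop := by
  by_cases hw : w ∈ tightCone L p x lam
  swap
  · rw [limitDensity, Set.indicator_of_notMem hw]; exact zero_le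
  rw [limitDensity, Set.indicator_of_mem hw]
  by_cases hw' : ∀ k, 0 < lam k → 0 ≤ w k
  swap
  · push Not at hw'
    obtain ⟨k, hk, hwk⟩ := hw'
    rw [Finset.prod_eq_zero (Finset.mem_univ k)]
    · exact zero_le
    · rw [limitFactor, if_pos hk, Set.indicator_of_notMem (by simpa using hwk)]
  rw [prod_limitFactor_eq h.dual_nonneg hw']
  have hlim := tendsto_localMatrix_mulVec (L := L) (lam := lam) w
  rw [localMatrix_zero_mulVec hL hd hlam] at hlim
  have hlimL : ∀ k, Tendsto (fun γ : ℝ => L.mulVec ((localMatrix L lam γ⁻¹).mulVec w) k) atTop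
      (𝓝 (L.mulVec (fun j => activeScale lam 0 j * w j) k)) := fun k => by
    have hc : Continuous fun y : Fin n → ℝ => L.mulVec y k :=
      (continuous_apply k).comp (by fun_prop : Continuous fun y : Fin n → ℝ => L.mulVec y)
    exact (hc.tendsto _).comp hlim
  have hmem : ∀ᶠ γ : ℝ in atTop,
      γ • x + (localMatrix L lam γ⁻¹).mulVec w ∈ feasible L (γ • p) := by
    have hk : ∀ k, ∀ᶠ γ : ℝ in atTop, (γ • p) k
        ≤ L.mulVec (γ • x + (localMatrix L lam γ⁻¹).mulVec w) k := fun k => by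
      simp only [Matrix.mulVec_add, Matrix.mulVec_smul, Pi.add_apply, Pi.smul_apply, smul_eq_mul]
      have hx := h.primal_feasible k
      -- Three kinds of constraint: active ones hold since w_k ≥ 0, slack inactive ones since the
      -- slack grows linearly in γ, tight inactive ones since the limiting direction is strictly
      -- feasible on the cone.
      by_cases hk : 0 < lam k
      · have hxk : L.mulVec x k = p k := mul_left_cancel₀ hk.ne' (h.mul_mulVec k)
        filter_upwards [eventually_gt_atTop 0] with γ hγ
        rw [mulVec_localMatrix_of_pos hL hd _ _ hk, hxk]
        have := mul_nonneg (inv_nonneg.2 hγ.le) (hw' k hk)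
        linarith
      · rcases hx.lt_or_eq with hlt | heq
        · have h1 : Tendsto (fun γ : ℝ => γ * (L.mulVec x k - p k)
              + L.mulVec ((localMatrix L lam γ⁻¹).mulVec w) k) atTop atTop :=
            (tendsto_id.atTop_mul_const (by linarith)).atTop_add (hlimL k)
          filter_upwards [h1.eventually_ge_atTop 0] with γ hγ
          linarith
        · have hxk : L.mulVec x k = p k := by linarith
          filter_upwards [(hlimL k).eventually (lt_mem_nhds (hw k hk hxk))] with γ hγ
          rw [hxk]
          linarith
    filter_upwards [eventually_all.2 hk] with γ hγ using hγ
  have hval : Tendsto (fun γ : ℝ => ENNReal.ofReal (Real.exp (-∑ k, lam k * w k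
      - ∑ k, (localMatrix L lam γ⁻¹).mulVec w k ^ 2 / 2))) atTop
      (𝓝 (ENNReal.ofReal (Real.exp (-∑ k, lam k * w k
        - ∑ k, (activeScale lam 0 k * w k) ^ 2 / 2)))) := by
    have hc : Continuous fun y : Fin n → ℝ => ENNReal.ofReal (Real.exp (-∑ k, lam k * w k
        - ∑ k, y k ^ 2 / 2)) := ENNReal.continuous_ofReal.comp (by fun_prop)
    exact (hc.tendsto _).comp hlim
  refine (Tendsto.liminf_eq (hval.congr' ?_)).ge
  filter_upwards [hmem] with γ hγ
  rw [localDensity, Set.indicator_of_mem (by exact hγ)]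

lemma le_liminf_lintegral_localDensity (hL : ∀ i j, i < j → L i j = 0) (hd : ∀ i, 0 < L i i)
    (h : IsKKT L p x lam) (hlam : ∀ j k, j ≤ k → 0 < lam k → 0 < lam j) :
    ∫⁻ w, limitDensity L p x lam w
      ≤ liminf (fun γ : ℝ => ∫⁻ w, localDensity L p x lam γ w) atTop :=
  (lintegral_mono fun w => limitDensity_le_liminf hL hd h hlam w).trans
    (lintegral_liminf_le fun γ => measurable_localDensity γ)

lemma lintegral_limitDensity_pos (hL : ∀ i j, i < j → L i j = 0) (hd : ∀ i, 0 < L i i)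
    (hnn : ∀ k, 0 ≤ lam k) (hlam : ∀ j k, j ≤ k → 0 < lam k → 0 < lam j) :
    0 < ∫⁻ w, limitDensity L p x lam w := by
  -- Deleting the off-diagonal entries in active columns keeps L triangular with positive diagonal,
  -- so L' z > 0 is solvable. Such a z is positive in the active coordinates and lies in the cone,
  -- so an open set of positive density is nonempty.
  set L' : Matrix (Fin n) (Fin n) ℝ :=
    Matrix.of fun k j => if 0 < lam j ∧ j ≠ k then 0 else L k j with hL'
  obtain ⟨z, hz⟩ := exists_seqLower_lt (L := L') (b := 0)
    (fun i j hij => by simp [hL', hL i j hij]) (fun i => by simp [hL', hd i])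
  have hz' : ∀ k, 0 < L'.mulVec z k := fun k =>
    (lt_mulVec_iff (L := L') (b := 0) (fun i j hij => by simp [hL', hL i j hij])
      (fun i => by simp [hL', hd i]) z k).2 (hz k)
  set V : Set (Fin n → ℝ) := tightCone L p x lam ∩ {w | ∀ k, 0 < lam k → 0 < w k} with hV
  have hVo : IsOpen V := by
    refine isOpen_tightCone.inter ?_
    simp only [Set.ofPred_forall]
    exact isOpen_iInter_of_finite fun k => isOpen_iInter_of_finite fun _ =>
      isOpen_lt continuous_const (continuous_apply k)
  have hzV : z ∈ V := by
    refine ⟨fun k hk _ => ?_, fun k hk => ?_⟩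
    · refine (hz' k).trans_eq ?_
      simp only [Matrix.mulVec, dotProduct]
      refine Finset.sum_congr rfl fun j _ => ?_
      by_cases hj : 0 < lam j
      · have hjk : j ≠ k := fun e => hk (e ▸ hj)
        simp [hL', activeScale, hj, hjk]
      · simp [hL', activeScale, hj]
    · have h1 := hz' k
      have h2 : L'.mulVec z k = L k k * z k := by
        rw [Matrix.mulVec, dotProduct, Finset.sum_eq_single k]
        · simp [hL']
        · intro j _ hjk
          rcases lt_or_gt_of_ne hjk with hlt | hgt
          · simp [hL', hlam j k hlt.le hk, hjk]
          · simp [hL', hL k j hgt]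
        · simp
      rw [h2] at h1
      exact pos_of_mul_pos_right h1 (hd k).le
  have hVpos : 0 < volume V := hVo.measure_pos volume ⟨z, hzV⟩
  have hmeas : Measurable (limitDensity L p x lam) :=
    (Finset.measurable_fun_prod _ fun k _ => (measurable_limitFactor k).comp
      (measurable_pi_apply k)).indicator isOpen_tightCone.measurableSet
  refine (lintegral_pos_iff_support hmeas).2 (hVpos.trans_le (measure_mono fun w hw => ?_))
  rw [Function.mem_support, limitDensity, Set.indicator_of_mem hw.1,
    prod_limitFactor_eq hnn fun k hk => (hw.2 k hk).le]
  simpa using Real.exp_pos _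

/-- Without tight inactive constraints the cone is the whole space, and the constants normalise the
exponential and Gaussian factors exactly. -/
lemma limitConst_mul_lintegral_limitDensity
    (htight : ∀ k, ¬ 0 < lam k → L.mulVec x k ≠ p k) :
    ENNReal.ofReal (∏ k, limitConst lam k) * ∫⁻ w, limitDensity L p x lam w = 1 := by
  have h : ∀ w, limitDensity L p x lam w = ∏ k, limitFactor lam k (w k) := fun w =>
    Set.indicator_of_mem (show w ∈ tightCone L p x lam from
      fun k hk hx => absurd hx (htight k hk)) _
  simp only [h]
  rw [lintegral_prod_eq_prod _ measurable_limitFactor,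
    ENNReal.ofReal_prod_of_nonneg fun k _ => (limitConst_pos k).le, ← Finset.prod_mul_distrib]
  refine Finset.prod_eq_one fun k _ => ?_
  rw [lintegral_limitFactor, ← ENNReal.ofReal_mul (limitConst_pos k).le,
    mul_inv_cancel₀ (limitConst_pos k).ne', ENNReal.ofReal_one]

/-- Lower bound for the Gaussian tail probability. -/
lemma eventually_mul_tailScale_lt (hL : ∀ i j, i < j → L i j = 0) (hd : ∀ i, 0 < L i i)
    (h : IsKKT L p x lam) (hlam : ∀ j k, j ≤ k → 0 < lam k → 0 < lam j) {c : ℝ} (hc : 0 < c)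
    (hcl : ENNReal.ofReal c
      < ENNReal.ofReal (∏ k, limitConst lam k) * ∫⁻ w, limitDensity L p x lam w) :
    ∀ᶠ γ : ℝ in atTop, c * tailScale L x lam γ
      < (Measure.pi fun _ : Fin n => gaussianReal 0 1).real (feasible L (γ • p)) := by
  have hκ : 0 < ∏ k, limitConst lam k := Finset.prod_pos fun k _ => limitConst_pos k
  have hκ0 : ENNReal.ofReal (∏ k, limitConst lam k) ≠ 0 := by simpa using hκ
  have h1 : (ENNReal.ofReal (∏ k, limitConst lam k))⁻¹ * ENNReal.ofReal c
      < liminf (fun γ : ℝ => ∫⁻ w, localDensity L p x lam γ w) atTop := by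
    refine lt_of_lt_of_le ?_ (le_liminf_lintegral_localDensity hL hd h hlam)
    rw [← ENNReal.div_eq_inv_mul, ENNReal.div_lt_iff (Or.inl hκ0) (Or.inl ENNReal.ofReal_ne_top),
      mul_comm]
    exact hcl
  filter_upwards [eventually_lt_of_lt_liminf h1, eventually_gt_atTop 0] with γ hγ hγ0
  have hs := tailScale_pos (x := x) (lam := lam) hd hγ0
  rw [← ENNReal.ofReal_lt_ofReal_iff_of_nonneg (by positivity), ofReal_measureReal,
    measure_feasible_eq hL hd h hγ0, mul_comm c, ENNReal.ofReal_mul hs.le]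
  refine ENNReal.mul_lt_mul_right (by simpa using hs) ENNReal.ofReal_ne_top ?_
  rwa [← ENNReal.div_eq_inv_mul, ENNReal.div_lt_iff (Or.inl hκ0) (Or.inl ENNReal.ofReal_ne_top),
    mul_comm] at hγ

end LimitingDensity

/-! ### Relative variance in the limit and the role of q -/

section Efficiency

open scoped ENNReal

/-- Asymptotic bound on the relative variance of the minimax estimator. -/
lemma limsup_relVariance_le {n : ℕ} {L : Matrix (Fin n) (Fin n) ℝ} {p x lam : Fin n → ℝ}
    (hL : ∀ i j, i < j → L i j = 0) (hd : ∀ i, 0 < L i i)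
    (h : IsKKT L p x lam) (hlam : ∀ j k, j ≤ k → 0 < lam k → 0 < lam j)
    {xs μs : ℝ → Fin n → ℝ}
    (hs : ∀ γ, 0 < γ → IsTiltingSolution L (γ • p) (xs γ) (μs γ)) {ell : ℝ → ℝ}
    (hell : ∀ γ, 0 < γ →
      ell γ = (Measure.pi fun _ : Fin n => gaussianReal 0 1).real (feasible L (γ • p)))
    {c : ℝ} (hc : 0 < c) (hcl : ENNReal.ofReal c
      < ENNReal.ofReal (∏ k, limitConst lam k) * ∫⁻ w, limitDensity L p x lam w) :
    limsup (fun γ => relVariance L (γ • p) (μs γ) (ell γ)) atTop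
      ≤ ENNReal.ofReal (c⁻¹ - 1) := by
  refine limsup_le_of_le (h := ?_)
  filter_upwards [eventually_mul_tailScale_lt hL hd h hlam hc hcl, eventually_gt_atTop 0]
    with γ hγ hγ0
  have hsc := tailScale_pos (x := x) (lam := lam) hd hγ0
  have hpos : 0 < (Measure.pi fun _ : Fin n => gaussianReal 0 1).real (feasible L (γ • p)) :=
    (mul_pos hc hsc).trans hγ
  rw [hell γ hγ0]
  refine (relVariance_le hL hd ((hs γ hγ0).exp_psi_le hL hd h hγ0) hpos).trans
    (ENNReal.ofReal_le_ofReal ?_)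
  gcongr
  rw [div_le_iff₀ hpos, ← div_eq_inv_mul, le_div_iff₀ hc, mul_comm]
  exact hγ.le

lemma castAdd_lt_natAdd {d₁ d₂ : ℕ} (i : Fin d₁) (j : Fin d₂) :
    Fin.castAdd d₂ i < Fin.natAdd d₁ j := by
  rw [Fin.lt_def, Fin.val_castAdd, Fin.val_natAdd]
  omega

/-- A constraint of the second block that is tight at the minimiser has `q = 0`. -/
lemma IsKKT.qVec_eq_zero {d₁ d₂ : ℕ} {L : Matrix (Fin (d₁ + d₂)) (Fin (d₁ + d₂)) ℝ}
    {p x lam : Fin (d₁ + d₂) → ℝ} (hL : ∀ i j, i < j → L i j = 0) (hd : ∀ i, 0 < L i i)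
    (h : IsKKT L p x lam) (h1 : ∀ i : Fin d₁, 0 < lam (Fin.castAdd d₂ i))
    (h2 : ∀ j : Fin d₂, lam (Fin.natAdd d₁ j) = 0) {j : Fin d₂}
    (hj : L.mulVec x (Fin.natAdd d₁ j) = p (Fin.natAdd d₁ j)) : qVec L p j = 0 := by
  -- The second block of x vanishes and the first solves L₁₁ x₁ = p₁, so q is the slack of the
  -- second block of constraints at x.
  have hx2 : ∀ j : Fin d₂, x (Fin.natAdd d₁ j) = 0 := fun j => by
    rw [h.eq_transpose, Matrix.mulVec, dotProduct, Fin.sum_univ_add]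
    have : ∀ i : Fin d₁, L (Fin.castAdd d₂ i) (Fin.natAdd d₁ j) = 0 := fun i =>
      hL _ _ (castAdd_lt_natAdd i j)
    simp [h2, this]
  set L₁₁ := L.submatrix (Fin.castAdd d₂) (Fin.castAdd d₂) with hL₁₁
  set L₂₁ := L.submatrix (Fin.natAdd d₁) (Fin.castAdd d₂) with hL₂₁
  have hp1 : (fun i => p (Fin.castAdd d₂ i)) = L₁₁.mulVec fun i => x (Fin.castAdd d₂ i) := by
    funext i
    rw [← mul_left_cancel₀ (h1 i).ne' (h.mul_mulVec (Fin.castAdd d₂ i))]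
    simp [Matrix.mulVec, dotProduct, Fin.sum_univ_add, hx2, hL₁₁]
  have hdet : IsUnit L₁₁.det := isUnit_det_of_lower
    (fun i k hik => hL _ _ hik) fun i => hd _
  rw [qVec, Pi.sub_apply, ← hL₁₁, ← hL₂₁, hp1, Matrix.mulVec_mulVec, Matrix.mul_assoc,
    Matrix.nonsing_inv_mul _ hdet, Matrix.mul_one, ← hj]
  simp [Matrix.mulVec, dotProduct, Fin.sum_univ_add, hx2, hL₂₁]

end Efficiency

end MinimaxTilting

theorem theorem1 (d₁ d₂ : ℕ)
    (S : Matrix (Fin (d₁ + d₂)) (Fin (d₁ + d₂)) ℝ) (hS : S.PosDef)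
    (l : Fin (d₁ + d₂) → ℝ) (hl : ∀ i, 0 < l i)
    (π : Equiv.Perm (Fin (d₁ + d₂)))
    (L : Matrix (Fin (d₁ + d₂)) (Fin (d₁ + d₂)) ℝ)
    (hL_lower : ∀ i j, i < j → L i j = 0) (hL_diag : ∀ i, 0 < L i i)
    (hL : L * L.transpose = S.submatrix π π)
    (p : Fin (d₁ + d₂) → ℝ) (hp : ∀ i, p i = l (π i))
    (hlam : ∀ γ : ℝ, 0 < γ → ∃ x lam : Fin (d₁ + d₂) → ℝ,
      MinimaxTilting.IsKKT L (γ • p) x lam ∧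
        (∀ i : Fin d₁, 0 < lam (Fin.castAdd d₂ i)) ∧
        (∀ j : Fin d₂, lam (Fin.natAdd d₁ j) = 0)) :
    (∀ γ : ℝ, 0 < γ →
      MinimaxTilting.tailProb S l γ =
        (multivariateGaussian (0 : EuclideanSpace ℝ (Fin (d₁ + d₂))) 1).real
          {z | ∀ i, γ * p i ≤ (L.mulVec z.ofLp) i}) ∧
    (∀ γ : ℝ, 0 < γ → ∃ x μ : Fin (d₁ + d₂) → ℝ,
      MinimaxTilting.IsTiltingSolution L (γ • p) x μ) ∧
    ∀ xstar mustar : ℝ → Fin (d₁ + d₂) → ℝ,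
      (∀ γ : ℝ, 0 < γ → MinimaxTilting.IsTiltingSolution L (γ • p) (xstar γ) (mustar γ)) →
      ({j : Fin d₂ | MinimaxTilting.qVec L p j = 0} = ∅ →
        limsup (fun γ : ℝ => MinimaxTilting.relVariance L (γ • p) (mustar γ)
          (MinimaxTilting.tailProb S l γ)) atTop = 0) ∧
      ({j : Fin d₂ | MinimaxTilting.qVec L p j = 0} ≠ ∅ →
        limsup (fun γ : ℝ => MinimaxTilting.relVariance L (γ • p) (mustar γ)
          (MinimaxTilting.tailProb S l γ)) atTop < ⊤) := by
  have hell : ∀ γ : ℝ, MinimaxTilting.tailProb S l γ =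
      (multivariateGaussian (0 : EuclideanSpace ℝ (Fin (d₁ + d₂))) 1).real
        {z | ∀ i, γ * p i ≤ (L.mulVec z.ofLp) i} := fun γ => by
    rw [MinimaxTilting.tailProb,
      MinimaxTilting.multivariateGaussian_real_eq hS.posSemidef π hL (fun i => γ * l i)]
    simp only [hp]
  have hfeas : ∀ γ : ℝ, 0 < γ → MinimaxTilting.tailProb S l γ =
      (Measure.pi fun _ : Fin (d₁ + d₂) => gaussianReal 0 1).real
        (MinimaxTilting.feasible L (γ • p)) := fun γ _ => by
    rw [hell γ, ← MinimaxTilting.stdGaussian_real_eq]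
    rfl
  -- One KKT pair at γ = 1 serves for all γ, since γ enters the bounds explicitly by scaling.
  obtain ⟨x, lam, hkkt, h1, h2⟩ := hlam 1 one_pos
  rw [one_smul] at hkkt
  have hinit : ∀ j k, j ≤ k → 0 < lam k → 0 < lam j := fun j k hjk hk => by
    induction j using Fin.addCases with
    | left i => exact h1 i
    | right i =>
      induction k using Fin.addCases with
      | left m => exact absurd hjk (not_le.2 (MinimaxTilting.castAdd_lt_natAdd m i))
      | right m => exact absurd hk (by simp [h2])
  refine ⟨fun γ _ => hell γ,
    fun γ _ => MinimaxTilting.exists_isTiltingSolution hL_lower hL_diag,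
    fun xs μs hs => ⟨fun hJ => ?_, fun _ => ?_⟩⟩
  · have htight : ∀ k, ¬ 0 < lam k → L.mulVec x k ≠ p k := fun k hk hx => by
      induction k using Fin.addCases with
      | left i => exact hk (h1 i)
      | right j =>
        exact (hJ.le (hkkt.qVec_eq_zero hL_lower hL_diag h1 h2 hx :
          j ∈ {j : Fin d₂ | MinimaxTilting.qVec L p j = 0}) : False)
    -- The limiting mass is 1, so the bound 1/c − 1 holds for every c in (0, 1); let c increase to
    -- 1.
    have hlim : Tendsto (fun c : ℝ => ENNReal.ofReal (c⁻¹ - 1)) (𝓝[<] 1) (𝓝 0) := by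
      have h : ContinuousAt (fun c : ℝ => c⁻¹ - 1) 1 :=
        (continuousAt_inv₀ one_ne_zero).sub continuousAt_const
      have h' := (ENNReal.tendsto_ofReal h.tendsto).mono_left
        (nhdsWithin_le_nhds (s := Set.Iio (1 : ℝ)))
      simpa using h'
    refine le_antisymm (ge_of_tendsto hlim ?_) zero_le
    filter_upwards [self_mem_nhdsWithin, nhdsWithin_le_nhds (Ioi_mem_nhds one_pos)]
      with c (hc1 : c < 1) (hc0 : 0 < c)
    refine MinimaxTilting.limsup_relVariance_le hL_lower hL_diag hkkt hinit hs hfeas hc0 ?_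
    rw [MinimaxTilting.limitConst_mul_lintegral_limitDensity htight]
    simpa using hc1
  -- Here the limiting mass is only known to be positive; any c strictly between 0 and it gives a
  -- finite bound.
  · have hpos : 0 < ENNReal.ofReal (∏ k, MinimaxTilting.limitConst lam k)
        * ∫⁻ w, MinimaxTilting.limitDensity L p x lam w :=
      ENNReal.mul_pos (by simpa using Finset.prod_pos fun k _ => MinimaxTilting.limitConst_pos k)
        (MinimaxTilting.lintegral_limitDensity_pos hL_lower hL_diag hkkt.dual_nonneg hinit).ne'
    obtain ⟨c, hc0, hcK⟩ := ENNReal.lt_iff_exists_nnreal_btwn.1 hpos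
    refine (MinimaxTilting.limsup_relVariance_le hL_lower hL_diag hkkt hinit hs hfeas
      (c := c) (by exact_mod_cast hc0) (by simpa using hcK)).trans_lt ENNReal.ofReal_lt_top
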